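/- Let $\mathbb D=\{z\in\mathbb C:|z|<1\}$ and let $\mathcal C$ be the class of close-to-convex functions, i.e. of holomorphic functions $f$ on $\mathbb D$ with $f(0)=0$, $f'(0)=1$ for which there is a holomorphic injective function $g$ on $\mathbb D$ with convex image $g(\mathbb D)$ (not necessarily normalized) such that $\operatorname{Re}\,(f'(z)/g'(z))>0$ for all $z\in\mathbb D$. For each $f\in\mathcal C$ there is a holomorphic branch of $\log(f(z)/z)$ on $\mathbb D$ that vanishes at $z=0$; this is the branch used below. The equation $$2b\left(\arctan b-\arctan\frac{3b}{\sqrt{1-8b^2}}+\pi\right)=\log\left(5-4b^2+3\sqrt{1-8b^2}\right)-\log 2$$ has exactly one solution $b_0$ in the interval $0<b<1/(2\sqrt2)$, and $b_0=0.24001\dots$. For every real $t$ with $|t|<\pi/2$, $$\inf_{z\in\mathbb D,\ f\in\mathcal C}\operatorname{Re}\left[e^{it}\log\frac{f(z)}{z}\right]= \begin{cases} -\dfrac12(\cos t)\log\left[2\left(9\cos^2t-4+3\cos^2t\sqrt{1-8\tan^2t}\right)\right]-(\sin t)\arctan\dfrac{3\tan t}{\sqrt{1-8\tan^2t}} & \text{if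 } |\tan t|\le b_0,\\[2ex] -(\cos t)\log(2\cos t)-|\sin t|\,(|t|+\pi) & \text{if } |\tan t|\ge b_0, \end{cases}$$ while the corresponding supremum is $$\Psi(t,\mathcal C)=\sup_{z\in\mathbb D,\ f\in\mathcal C}\operatorname{Re}\left[e^{it}\log\frac{f(z)}{z}\right]=+\infty .$$ -/

import Mathlib

namespace CloseToConvex

/-- The open unit disk of the complex plane. -/
def disk : Set ℂ := Metric.ball 0 1

/-- `g` is a (not necessarily normalized) convex function on the unit disk: it is holomorphic and
univalent there, and the image of the disk is a convex set. -/
def IsConvexUnivalent (g : ℂ → ℂ) : Prop :=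
  DifferentiableOn ℂ g disk ∧ Set.InjOn g disk ∧ Convex ℝ (g '' disk)

/-- The class of normalized close-to-convex (linearly accessible) functions: `f` is holomorphic on
the unit disk, `f 0 = 0`, `f' 0 = 1`, and `Re (f' / g') > 0` on the disk for some convex function
`g`. The function `g` is not normalized, so it absorbs a rotation factor. Only the values of `f` on
the disk matter. -/
def closeToConvex : Set (ℂ → ℂ) :=
  {f | DifferentiableOn ℂ f disk ∧ f 0 = 0 ∧ deriv f 0 = 1 ∧
    ∃ g : ℂ → ℂ, IsConvexUnivalent g ∧ ∀ z ∈ disk, 0 < (deriv f z / deriv g z).re}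

/-- `L` is the holomorphic branch of `log (f z / z)` on the unit disk with `L 0 = 0`. On the disk it
is determined by `f`. -/
def IsLogBranch (f L : ℂ → ℂ) : Prop :=
  DifferentiableOn ℂ L disk ∧ L 0 = 0 ∧ ∀ z ∈ disk, z ≠ 0 → Complex.exp (L z) = f z / z

/-- The set of all values `Re (e^{it} log (f z / z))`, where `f` runs over the class `F` and `z`
over the unit disk. -/
def extremalValues (t : ℝ) (F : Set (ℂ → ℂ)) : Set ℝ :=
  {x | ∃ f ∈ F, ∃ L : ℂ → ℂ, IsLogBranch f L ∧
    ∃ z ∈ disk, x = (Complex.exp (t * Complex.I) * L z).re}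

/-- `b` lies in `(0, 1 / (2 √2))` and solves the transcendental equation that defines `b₀`. -/
def IsThreshold (b : ℝ) : Prop :=
  0 < b ∧ b < 1 / (2 * √2) ∧
    2 * b * (Real.arctan b - Real.arctan (3 * b / √(1 - 8 * b ^ 2)) + Real.pi) =
      Real.log (5 - 4 * b ^ 2 + 3 * √(1 - 8 * b ^ 2)) - Real.log 2

end CloseToConvex

/-!
The values of `log (f z / z)` are confined to a region with two kinds of boundary, and the infimum is
a maximum of `-Re L + b * |Im L|`, with `b = |tan t|`, over that region.

Let `h` be the normalization of the convex function `g` that belongs to `f`. The difference quotient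
`Q x = (f x - f z) / (g x - g z)` has positive real part (`re_div_sub_pos`), and comparing derivatives
at the origin in `Q * (g - g z) = f - f z` gives `z / f z = z / h z - z * Q' 0 / Q 0`. The theorem of
Marx and Strohhäcker, proved through Jack's lemma, puts the first term within distance `1` of the
point `1`, and Carathéodory's coefficient bound makes the second at most `2` in modulus. Hence
`w = f z / z` satisfies `|1 / w - 1| < 3` (`norm_div_sub_one_lt`).

This bound does not see the sheet of the logarithm. Write `w = s * M` with `s = h z / z` in the right
half-plane and `M` off the negative real axis, so that `log w = log s + log M`
(`exists_factorization`). All functions `(1 - τ) * h + τ * f` belong to the class, so the planar bound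
holds along the segment from `s` to `w`. If `arg s + arg M > π`, this segment crosses the negative
real axis, by the planar bound to the left of `-1 / 2`, and it starts in the right half-plane;
therefore `Re w < -1 / 2` (`re_mul_lt_of_pi_lt_arg_add_arg`).

On the part with `|Im L| ≤ π` the maximum of `-Re L + b * |Im L|` is attained on the circle
`|1 / w - 1| = 3`, with value `arcSup b`, or at argument `π`; on the rest it is attained on the line
`Re w = -1 / 2`, with value `lineSup b`, which is at least the value at argument `π`. Since `lineSup`
grows faster than `arcSup`, they agree at a single point, the threshold (`lineSup_sub_arcSup_lt`).
Both values are approached by functions with derivative `(1 - x z) / (1 - y z) ^ 3`, where `|x| ≤ 1`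
and `|y| = 1` (`le_arc_value`, `le_line_value`), and the Koebe function makes the supremum infinite.
-/

namespace CloseToConvex

open Set Metric Filter Topology

/-! ### Functions on the disk with convex image or positive real part -/

theorem mem_disk {z : ℂ} : z ∈ disk ↔ ‖z‖ < 1 := by simp [disk]

theorem isOpen_disk : IsOpen disk := isOpen_ball

theorem zero_mem_disk : (0 : ℂ) ∈ disk := by simp [disk]

theorem disk_mem_nhds {z : ℂ} (hz : z ∈ disk) : disk ∈ 𝓝 z := isOpen_disk.mem_nhds hz

theorem _root_.DifferentiableOn.hasDerivAt_disk {f : ℂ → ℂ} (hf : DifferentiableOn ℂ f disk)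
    {z : ℂ} (hz : z ∈ disk) : HasDerivAt f (deriv f z) z :=
  (hf.differentiableAt (disk_mem_nhds hz)).hasDerivAt

theorem _root_.DifferentiableOn.deriv_disk {f : ℂ → ℂ} (hf : DifferentiableOn ℂ f disk) :
    DifferentiableOn ℂ (deriv f) disk := hf.deriv isOpen_disk

theorem _root_.DifferentiableOn.dslope_disk {f : ℂ → ℂ} (hf : DifferentiableOn ℂ f disk)
    {a : ℂ} (ha : a ∈ disk) : DifferentiableOn ℂ (dslope f a) disk :=
  (Complex.differentiableOn_dslope (disk_mem_nhds ha)).2 hf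

/-- The inverse of a univalent function is holomorphic on its image. -/
theorem hasDerivAt_invFunOn {g : ℂ → ℂ} (hg : DifferentiableOn ℂ g disk) (hinj : InjOn g disk)
    {z : ℂ} (hz : z ∈ disk) (hd : deriv g z ≠ 0) :
    HasDerivAt (Function.invFunOn g disk) (deriv g z)⁻¹ (g z) := by
  have hs : HasStrictDerivAt g (deriv g z) z :=
    (hg.analyticAt (disk_mem_nhds hz)).hasStrictDerivAt
  refine (hs.to_local_left_inverse hd ?_).hasDerivAt
  filter_upwards [disk_mem_nhds hz] with x hx
  exact hinj.leftInvOn_invFunOn hx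

theorem invFunOn_apply {g : ℂ → ℂ} (hinj : InjOn g disk) {z : ℂ} (hz : z ∈ disk) :
    Function.invFunOn g disk (g z) = z := hinj.leftInvOn_invFunOn hz

theorem invFunOn_mem_disk {g : ℂ → ℂ} {w : ℂ} (hw : w ∈ g '' disk) :
    Function.invFunOn g disk w ∈ disk ∧ g (Function.invFunOn g disk w) = w :=
  ⟨Function.invFunOn_mem hw, Function.invFunOn_eq hw⟩

/-- The mean value argument of Noshiro and Warschawski: along the segment from `g a` to `g z`,
which lies in the convex image of `g`, the real part of `f ∘ g⁻¹` divided by the direction of the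
segment increases, because its derivative is `Re (f' / g')`. -/
theorem re_div_sub_pos {f g : ℂ → ℂ} (hf : DifferentiableOn ℂ f disk) (hg : IsConvexUnivalent g)
    (hre : ∀ z ∈ disk, 0 < (deriv f z / deriv g z).re) {a z : ℂ} (ha : a ∈ disk) (hz : z ∈ disk)
    (hne : z ≠ a) : 0 < ((f z - f a) / (g z - g a)).re := by
  obtain ⟨hgd, hinj, hconv⟩ := hg
  have hw : g z - g a ≠ 0 := sub_ne_zero.2 fun h => hne (hinj hz ha h)
  set γ : ℝ → ℂ := fun s => g a + s * (g z - g a) with hγ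
  have hmem : ∀ s ∈ Icc (0 : ℝ) 1, γ s ∈ g '' disk := by
    intro s hs
    have := hconv (mem_image_of_mem g ha) (mem_image_of_mem g hz) (sub_nonneg.2 hs.2) hs.1
      (by ring)
    convert this using 1
    simp only [hγ, Complex.real_smul]
    push_cast
    ring
  set F : ℝ → ℂ := fun s => f (Function.invFunOn g disk (γ s)) / (g z - g a) with hF
  have hder : ∀ s ∈ Icc (0 : ℝ) 1, HasDerivAt F
      (deriv f (Function.invFunOn g disk (γ s)) / deriv g (Function.invFunOn g disk (γ s))) s := by
    intro s hs
    obtain ⟨hx, hgx⟩ := invFunOn_mem_disk (hmem s hs)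
    set x := Function.invFunOn g disk (γ s) with hxdef
    have hd : deriv g x ≠ 0 := by
      intro h
      have := hre x hx
      simp [h] at this
    have h1 := hasDerivAt_invFunOn hgd hinj hx hd
    rw [hgx] at h1
    have h2 : HasDerivAt γ (g z - g a) s := by
      have := ((hasDerivAt_id s).ofReal_comp.mul_const (g z - g a)).const_add (g a)
      simpa [hγ] using this
    have h3 := h1.comp s h2
    have h4 : HasDerivAt f (deriv f x) (Function.invFunOn g disk (γ s)) := hf.hasDerivAt_disk hx
    have h5 := (h4.comp s h3).div_const (g z - g a)
    refine h5.congr_deriv ?_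
    rw [div_eq_mul_inv, ← mul_assoc]
    exact mul_div_cancel_right₀ _ hw
  have hre' : ∀ s ∈ Icc (0 : ℝ) 1, HasDerivAt (fun s => (F s).re)
      (deriv f (Function.invFunOn g disk (γ s)) / deriv g (Function.invFunOn g disk (γ s))).re s :=
    fun s hs => Complex.reCLM.hasFDerivAt.comp_hasDerivAt s (hder s hs)
  obtain ⟨c, hc, hceq⟩ := exists_hasDerivAt_eq_slope (fun s => (F s).re) _ zero_lt_one
    (fun s hs => (hre' s hs).continuousAt.continuousWithinAt)
    (fun s hs => hre' s (Ioo_subset_Icc_self hs))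
  have hpos := hre _ (invFunOn_mem_disk (hmem c (Ioo_subset_Icc_self hc))).1
  rw [hceq] at hpos
  have e1 : γ 1 = g z := by simp [hγ]
  have e0 : γ 0 = g a := by simp [hγ]
  simp only [hF, e1, e0, invFunOn_apply hinj hz, invFunOn_apply hinj ha, sub_zero, div_one] at hpos
  rwa [← Complex.sub_re, ← sub_div] at hpos

/-- Carathéodory's bound for the first coefficient of a function with positive real part. -/
theorem norm_deriv_le_two_mul_re {Q : ℂ → ℂ} (hQ : DifferentiableOn ℂ Q disk)
    (hre : ∀ z ∈ disk, 0 < (Q z).re) : ‖deriv Q 0‖ ≤ 2 * (Q 0).re := by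
  have h0 := hre 0 zero_mem_disk
  set c := Q 0 with hc
  have hden : ∀ z ∈ disk, Q z + (starRingEnd ℂ) c ≠ 0 := by
    intro z hz h
    have := congrArg Complex.re h
    simp at this
    linarith [hre z hz]
  set U : ℂ → ℂ := fun z => (Q z - c) / (Q z + (starRingEnd ℂ) c) with hU
  have hUd : DifferentiableOn ℂ U disk := (hQ.sub_const c).div (hQ.add_const _) hden
  have hU0 : U 0 = 0 := by simp [hU, hc]
  have hmaps : MapsTo U (ball 0 1) (closedBall (U 0) 1) := by
    intro z hz
    rw [hU0, mem_closedBall_zero_iff, norm_div]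
    refine div_le_one_of_le₀ ?_ (norm_nonneg _)
    rw [← sq_le_sq₀ (norm_nonneg _) (norm_nonneg _), Complex.sq_norm, Complex.sq_norm,
      Complex.normSq_apply, Complex.normSq_apply]
    simp
    nlinarith [mul_pos h0 (hre z hz)]
  have hS := Complex.norm_deriv_le_one_of_mapsTo_ball hUd hmaps one_pos
  have hsum : c + (starRingEnd ℂ) c = ((2 * c.re : ℝ) : ℂ) := by
    rw [Complex.add_conj]
  have hderiv : HasDerivAt U (deriv Q 0 / (2 * c.re : ℝ)) 0 := by
    have h1 := hQ.hasDerivAt_disk zero_mem_disk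
    have h2 := (h1.sub_const c).div (h1.add_const ((starRingEnd ℂ) c)) (hden 0 zero_mem_disk)
    refine h2.congr_deriv ?_
    rw [← hc, sub_self, zero_mul, sub_zero, hsum]
    have : ((2 * c.re : ℝ) : ℂ) ≠ 0 := by
      rw [Ne, Complex.ofReal_eq_zero]; linarith
    field_simp
  rw [hderiv.deriv, norm_div, Complex.norm_real, Real.norm_of_nonneg (by linarith),
    div_le_one (by linarith)] at hS
  exact hS

/-- Bieberbach's bound `|a₂| ≤ 1` for convex functions. Averaging over `ζ ↦ -ζ` stays in the convex
image, so `g⁻¹ ∘ (g ζ + g (-ζ)) / 2` is a self-map of the disk that vanishes to second order at the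
origin, and the Schwarz lemma bounds it by `|ζ|²`. -/
theorem IsConvexUnivalent.norm_deriv_dslope_le {g : ℂ → ℂ} (hg : IsConvexUnivalent g)
    (hd : ∀ z ∈ disk, deriv g z ≠ 0) : ‖deriv (dslope g 0) 0‖ ≤ ‖deriv g 0‖ := by
  obtain ⟨hgd, hinj, hconv⟩ := hg
  have hneg : ∀ {z : ℂ}, z ∈ disk → -z ∈ disk := fun hz => by
    rw [mem_disk] at *; simpa using hz
  set A : ℂ → ℂ := fun z => (g z + g (-z)) / 2 with hA
  have hAmem : ∀ z ∈ disk, A z ∈ g '' disk := by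
    intro z hz
    have := hconv (mem_image_of_mem g hz) (mem_image_of_mem g (hneg hz))
      (by norm_num : (0 : ℝ) ≤ 1 / 2) (by norm_num : (0 : ℝ) ≤ 1 / 2) (by norm_num)
    convert this using 1
    simp only [hA, Complex.real_smul]
    push_cast
    ring
  set ω : ℂ → ℂ := fun z => Function.invFunOn g disk (A z) with hω
  have hωmem : ∀ z ∈ disk, ω z ∈ disk := fun z hz => (invFunOn_mem_disk (hAmem z hz)).1
  have hgω : ∀ z ∈ disk, g (ω z) = A z := fun z hz => (invFunOn_mem_disk (hAmem z hz)).2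
  have hAder : ∀ z ∈ disk, HasDerivAt A ((deriv g z - deriv g (-z)) / 2) z := by
    intro z hz
    have h1 := hgd.hasDerivAt_disk hz
    have h2 := (hgd.hasDerivAt_disk (hneg hz)).comp z (hasDerivAt_neg z)
    exact ((h1.add h2).div_const 2).congr_deriv (by ring)
  have hωder : ∀ z ∈ disk, HasDerivAt ω ((deriv g (ω z))⁻¹ * ((deriv g z - deriv g (-z)) / 2)) z := by
    intro z hz
    have h1 := hasDerivAt_invFunOn hgd hinj (hωmem z hz) (hd _ (hωmem z hz))
    rw [hgω z hz] at h1
    exact h1.comp z (hAder z hz)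
  have hω0 : ω 0 = 0 := by
    have : A 0 = g 0 := by simp [hA]
    simp only [hω, this, invFunOn_apply hinj zero_mem_disk]
  have hlittle : (fun z => ω z - ω 0) =o[𝓝 0] fun z : ℂ => ‖z - 0‖ ^ 1 := by
    have h := hωder 0 zero_mem_disk
    simp only [neg_zero, sub_self, zero_div, mul_zero] at h
    have h := h.isLittleO
    simp only [smul_zero, sub_zero] at h
    simpa using h.norm_right
  have hbound : ∀ z ∈ disk, ‖ω z‖ ≤ ‖z‖ ^ 2 := by
    intro z hz
    have := Complex.dist_le_mul_div_pow_of_mapsTo_ball_of_isLittleO (R₂ := 1) (n := 1)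
      (fun z hz => (hωder z hz).differentiableAt.differentiableWithinAt)
      (fun z hz => by rw [hω0]; exact ball_subset_closedBall (hωmem z hz)) hlittle hz
    simpa [hω0] using this
  set D := dslope g 0 with hD
  have hgD : ∀ z, g z = g 0 + z * D z := by
    intro z
    have := sub_smul_dslope g 0 z
    rw [sub_zero, smul_eq_mul] at this
    rw [hD, this]; ring
  have hDd := hgd.dslope_disk zero_mem_disk
  have hDder : HasDerivAt (fun z => (D z - D (-z)) / 2) (deriv D 0) 0 := by
    have h1 := hDd.hasDerivAt_disk zero_mem_disk
    have h1' : HasDerivAt D (deriv D 0) (-0) := by simpa using h1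
    have h2 := h1'.comp 0 (hasDerivAt_neg (0 : ℂ))
    exact ((h1.sub h2).div_const 2).congr_deriv (by ring)
  have hlim1 := (hasDerivAt_iff_tendsto_slope.1 hDder).norm
  have hcont : ContinuousAt (fun z => D (ω z)) 0 := by
    refine ContinuousAt.comp (g := D) ?_ (hωder 0 zero_mem_disk).continuousAt
    rw [hω0]
    exact (hDd.hasDerivAt_disk zero_mem_disk).continuousAt
  have hlim2 : Tendsto (fun z => ‖D (ω z)‖) (𝓝[≠] 0) (𝓝 ‖deriv g 0‖) := by
    have := hcont.norm.tendsto
    rw [hω0, hD, dslope_same] at this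
    exact this.mono_left nhdsWithin_le_nhds
  refine le_of_tendsto_of_tendsto hlim1 hlim2 ?_
  filter_upwards [nhdsWithin_le_nhds (disk_mem_nhds zero_mem_disk), self_mem_nhdsWithin]
    with z hz hz0
  have hz0 : z ≠ 0 := hz0
  have key : z * ((D z - D (-z)) / 2) = ω z * D (ω z) := by
    have h1 := hgω z hz
    simp only [hA] at h1
    rw [hgD (ω z), hgD z, hgD (-z)] at h1
    linear_combination -h1
  have hslope : slope (fun z => (D z - D (-z)) / 2) 0 z = (ω z / z ^ 2) * D (ω z) := by
    rw [slope_def_field]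
    simp only [neg_zero, sub_self, zero_div, sub_zero]
    field_simp
    linear_combination 2 * key
  rw [hslope, norm_mul, norm_div, norm_pow]
  exact mul_le_of_le_one_left (norm_nonneg _)
    (div_le_one_of_le₀ (hbound z hz) (by positivity))

/-! ### Analytic convexity and Jack's lemma -/

theorem IsConvexUnivalent.const_mul_add {g : ℂ → ℂ} (hg : IsConvexUnivalent g) {c : ℂ}
    (hc : c ≠ 0) (d : ℂ) : IsConvexUnivalent fun z => c * g z + d := by
  obtain ⟨hgd, hinj, hconv⟩ := hg
  refine ⟨(hgd.const_mul c).add_const d, fun x hx y hy h => ?_, ?_⟩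
  · have h : c * g x + d = c * g y + d := h
    exact hinj hx hy (mul_left_cancel₀ hc (add_right_cancel h))
  · have := (hconv.linear_image (LinearMap.mulLeft ℝ c)).translate d
    rw [image_image, image_image] at this
    simpa only [LinearMap.mulLeft_apply, add_comm d] using this

theorem two_mul_deriv_dslope {k : ℂ → ℂ} (hk : DifferentiableOn ℂ k disk) :
    2 * deriv (dslope k 0) 0 = deriv (deriv k) 0 := by
  have hD := hk.dslope_disk zero_mem_disk
  have h1 : ∀ z ∈ disk, deriv k z = dslope k 0 z + z * deriv (dslope k 0) z := by
    intro z hz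
    have hk' : k = fun z => k 0 + z * dslope k 0 z := by
      ext z
      have := sub_smul_dslope k 0 z
      rw [sub_zero, smul_eq_mul] at this
      rw [this]; ring
    have h := (((hasDerivAt_id z).mul (hD.hasDerivAt_disk hz)).const_add (k 0)).deriv
    rw [one_mul] at h
    exact (congrArg (fun F => deriv F z) hk').trans h
  have h2 : deriv k =ᶠ[𝓝 0] fun z => dslope k 0 z + z * deriv (dslope k 0) z :=
    Filter.eventually_of_mem (disk_mem_nhds zero_mem_disk) h1
  have h3 := ((hD.hasDerivAt_disk zero_mem_disk).add
    ((hasDerivAt_id (0 : ℂ)).mul (hD.deriv_disk.hasDerivAt_disk zero_mem_disk)))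
  rw [h2.deriv_eq]
  refine Eq.symm (h3.deriv.trans ?_)
  simp only [id, one_mul, zero_mul, add_zero]
  ring

/-- The disk automorphism `ζ ↦ (ζ + a) / (1 + conj a * ζ)`, which carries `0` to `a`. -/
noncomputable def koebeShift (a ζ : ℂ) : ℂ := (ζ + a) / (1 + (starRingEnd ℂ) a * ζ)

theorem one_add_conj_mul_ne_zero {a z : ℂ} (ha : a ∈ disk) (hz : z ∈ disk) :
    1 + (starRingEnd ℂ) a * z ≠ 0 := by
  rw [mem_disk] at ha hz
  intro h
  have h1 : ‖(starRingEnd ℂ) a * z‖ = 1 := by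
    rw [eq_neg_of_add_eq_zero_right h]; simp
  rw [norm_mul, RCLike.norm_conj] at h1
  nlinarith [norm_nonneg a, norm_nonneg z]

theorem koebeShift_mem_disk {a z : ℂ} (ha : a ∈ disk) (hz : z ∈ disk) :
    koebeShift a z ∈ disk := by
  have hne := one_add_conj_mul_ne_zero ha hz
  rw [mem_disk] at *
  rw [koebeShift, norm_div, div_lt_one (norm_pos_iff.2 hne),
    ← sq_lt_sq₀ (norm_nonneg _) (norm_nonneg _), Complex.sq_norm, Complex.sq_norm]
  have h1 : Complex.normSq a < 1 := by
    rw [Complex.normSq_eq_norm_sq]; nlinarith [norm_nonneg a]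
  have h2 : Complex.normSq z < 1 := by
    rw [Complex.normSq_eq_norm_sq]; nlinarith [norm_nonneg z]
  have h3 : Complex.normSq (1 + (starRingEnd ℂ) a * z) - Complex.normSq (z + a)
      = (1 - Complex.normSq a) * (1 - Complex.normSq z) := by
    simp only [Complex.normSq_apply, Complex.add_re, Complex.add_im, Complex.mul_re,
      Complex.mul_im, Complex.conj_re, Complex.conj_im, Complex.one_re, Complex.one_im]
    ring
  nlinarith [mul_pos (sub_pos.2 h1) (sub_pos.2 h2)]

theorem koebeShift_neg_koebeShift {a z : ℂ} (ha : a ∈ disk) (hz : z ∈ disk) :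
    koebeShift (-a) (koebeShift a z) = z := by
  have h1 := one_add_conj_mul_ne_zero ha hz
  have h2 := one_add_conj_mul_ne_zero (a := -a) (by rw [mem_disk] at *; simpa using ha)
    (koebeShift_mem_disk ha hz)
  have h3 := one_add_conj_mul_ne_zero (a := -a) (by rw [mem_disk] at *; simpa using ha) ha
  rw [map_neg] at h2 h3
  rw [koebeShift, map_neg, div_eq_iff h2, koebeShift]
  linear_combination div_mul_cancel₀ (z + a) h1

theorem hasDerivAt_koebeShift {a z : ℂ} (ha : a ∈ disk) (hz : z ∈ disk) :
    HasDerivAt (koebeShift a)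
      ((1 - a * (starRingEnd ℂ) a) / (1 + (starRingEnd ℂ) a * z) ^ 2) z := by
  have h1 := one_add_conj_mul_ne_zero ha hz
  have h2 := ((hasDerivAt_id z).add_const a).div
    (((hasDerivAt_id z).const_mul ((starRingEnd ℂ) a)).const_add 1) h1
  refine h2.congr_deriv ?_
  simp only [id]
  congr 1
  ring

theorem image_koebeShift {a : ℂ} (ha : a ∈ disk) : koebeShift a '' disk = disk := by
  have ha' : -a ∈ disk := by rw [mem_disk] at *; simpa using ha
  apply Subset.antisymm
  · rintro _ ⟨z, hz, rfl⟩
    exact koebeShift_mem_disk ha hz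
  · intro z hz
    refine ⟨koebeShift (-a) z, koebeShift_mem_disk ha' hz, ?_⟩
    simpa using koebeShift_neg_koebeShift ha' hz

/-- The analytic form of convexity, `Re (1 + z g'' / g') > 0`: the bound on the second coefficient,
applied to the composition of `g` with the automorphism that carries `0` to `a`. -/
theorem IsConvexUnivalent.re_one_add_pos {g : ℂ → ℂ} (hg : IsConvexUnivalent g)
    (hd : ∀ z ∈ disk, deriv g z ≠ 0) {a : ℂ} (ha : a ∈ disk) :
    0 < (1 + a * (deriv (deriv g) a / deriv g a)).re := by
  obtain ⟨hgd, hinj, hconv⟩ := hg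
  set k : ℂ → ℂ := fun z => g (koebeShift a z) with hk
  have hsd : ∀ z ∈ disk, 1 + (starRingEnd ℂ) a * z ≠ 0 := fun z hz => one_add_conj_mul_ne_zero ha hz
  have hA : (1 : ℂ) - a * (starRingEnd ℂ) a = ((1 - ‖a‖ ^ 2 : ℝ) : ℂ) := by
    rw [Complex.mul_conj, Complex.normSq_eq_norm_sq]; push_cast; rfl
  have ha1 : ‖a‖ < 1 := mem_disk.1 ha
  have hApos : 0 < 1 - ‖a‖ ^ 2 := by nlinarith [norm_nonneg a]
  have hA0 : (1 : ℂ) - a * (starRingEnd ℂ) a ≠ 0 := by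
    rw [hA, Ne, Complex.ofReal_eq_zero]; exact hApos.ne'
  have hkder : ∀ z ∈ disk, HasDerivAt k (deriv g (koebeShift a z) *
      ((1 - a * (starRingEnd ℂ) a) / (1 + (starRingEnd ℂ) a * z) ^ 2)) z := fun z hz =>
    (hgd.hasDerivAt_disk (koebeShift_mem_disk ha hz)).comp z (hasDerivAt_koebeShift ha hz)
  have hkd : DifferentiableOn ℂ k disk := fun z hz =>
    (hkder z hz).differentiableAt.differentiableWithinAt
  have hkconv : IsConvexUnivalent k := by
    refine ⟨hkd, fun x hx y hy h => ?_, ?_⟩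
    · have := hinj (koebeShift_mem_disk ha hx) (koebeShift_mem_disk ha hy) h
      rw [← koebeShift_neg_koebeShift ha hx, this, koebeShift_neg_koebeShift ha hy]
    · have : k '' disk = g '' disk := by
        rw [hk, ← image_image g (koebeShift a), image_koebeShift ha]
      rwa [this]
  have hkd0 : ∀ z ∈ disk, deriv k z ≠ 0 := by
    intro z hz
    rw [(hkder z hz).deriv]
    exact mul_ne_zero (hd _ (koebeShift_mem_disk ha hz)) (div_ne_zero hA0 (pow_ne_zero 2 (hsd z hz)))
  have hshift0 : koebeShift a 0 = a := by simp [koebeShift]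
  have hk2 : deriv (deriv k) 0 = deriv (deriv g) a * (1 - a * (starRingEnd ℂ) a) ^ 2
      - 2 * (starRingEnd ℂ) a * (1 - a * (starRingEnd ℂ) a) * deriv g a := by
    have h1 : deriv k =ᶠ[𝓝 0] fun z => deriv g (koebeShift a z) *
        ((1 - a * (starRingEnd ℂ) a) / (1 + (starRingEnd ℂ) a * z) ^ 2) :=
      Filter.eventually_of_mem (disk_mem_nhds zero_mem_disk) fun z hz => (hkder z hz).deriv
    rw [h1.deriv_eq]
    have h2 : HasDerivAt (deriv g) (deriv (deriv g) a) (koebeShift a 0) := by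
      rw [hshift0]; exact hgd.deriv_disk.hasDerivAt_disk ha
    have h3 := h2.comp 0 (hasDerivAt_koebeShift ha zero_mem_disk)
    have h4 : HasDerivAt (fun z : ℂ => (1 + (starRingEnd ℂ) a * z) ^ 2)
        (2 * (starRingEnd ℂ) a) 0 := by
      have := (((hasDerivAt_id (0 : ℂ)).const_mul ((starRingEnd ℂ) a)).const_add 1).pow 2
      exact this.congr_deriv (by simp)
    have h5 := (hasDerivAt_const (0 : ℂ) (1 - a * (starRingEnd ℂ) a)).div h4 (by simp)
    refine (h3.mul h5).deriv.trans ?_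
    simp only [Function.comp, Pi.div_apply, hshift0]
    simp
    ring
  have hbound := hkconv.norm_deriv_dslope_le hkd0
  have h2 : ‖deriv (deriv k) 0‖ ≤ 2 * ‖deriv k 0‖ := by
    rw [← two_mul_deriv_dslope hkd, norm_mul]
    simpa using hbound
  rw [hk2, (hkder 0 zero_mem_disk).deriv, hshift0] at h2
  have hga := hd a ha
  set T := deriv (deriv g) a / deriv g a with hT
  have hfac : deriv (deriv g) a * (1 - a * (starRingEnd ℂ) a) ^ 2
      - 2 * (starRingEnd ℂ) a * (1 - a * (starRingEnd ℂ) a) * deriv g a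
      = (T * (1 - a * (starRingEnd ℂ) a) - 2 * (starRingEnd ℂ) a) *
        (deriv g a * ((1 - a * (starRingEnd ℂ) a) / (1 + (starRingEnd ℂ) a * 0) ^ 2)) := by
    rw [hT]
    field_simp
    ring
  rw [hfac, norm_mul] at h2
  have hpos : 0 < ‖deriv g a * ((1 - a * (starRingEnd ℂ) a) / (1 + (starRingEnd ℂ) a * 0) ^ 2)‖ :=
    norm_pos_iff.2 (mul_ne_zero hga (div_ne_zero hA0 (by simp)))
  have h3 := le_of_mul_le_mul_right h2 hpos
  have h4 : ‖a * T * ((1 - ‖a‖ ^ 2 : ℝ) : ℂ) - ((2 * ‖a‖ ^ 2 : ℝ) : ℂ)‖ ≤ 2 * ‖a‖ := by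
    have : a * T * ((1 - ‖a‖ ^ 2 : ℝ) : ℂ) - ((2 * ‖a‖ ^ 2 : ℝ) : ℂ)
        = a * (T * (1 - a * (starRingEnd ℂ) a) - 2 * (starRingEnd ℂ) a) := by
      have h : a * (starRingEnd ℂ) a = ((‖a‖ ^ 2 : ℝ) : ℂ) := by
        rw [Complex.mul_conj, Complex.normSq_eq_norm_sq]
      push_cast at h ⊢
      linear_combination (a * T + 2) * h
    rw [this, norm_mul]
    nlinarith [norm_nonneg a]
  have h5 := (abs_le.1 ((Complex.abs_re_le_norm _).trans h4)).1
  rw [Complex.sub_re, Complex.re_mul_ofReal, Complex.ofReal_re] at h5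
  rw [Complex.add_re, Complex.one_re]
  by_contra hcon
  have hcon' : (a * T).re ≤ -1 := by linarith
  nlinarith [mul_le_mul_of_nonneg_right hcon' hApos.le, sq_nonneg (1 - ‖a‖), norm_nonneg a]

/-- A consequence of Jack's lemma: at the first point `z` where `|ω|` reaches `1`, the quotient
`z ω' / ω` is real and at least `1`. Excluding such points shows that `|ω| < 1`. -/
theorem norm_lt_one_of_jack {ω : ℂ → ℂ} (hω : DifferentiableOn ℂ ω disk) (h0 : ω 0 = 0)
    (h : ∀ z ∈ disk, ∀ m : ℝ, 1 ≤ m → ‖ω z‖ = 1 → z * deriv ω z = m * ω z → False) :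
    ∀ z ∈ disk, ‖ω z‖ < 1 := by
  intro z₁ hz₁
  by_contra hcon
  rw [not_lt] at hcon
  have hsub : closedBall (0 : ℂ) ‖z₁‖ ⊆ disk := fun z hz => by
    rw [mem_closedBall_zero_iff] at hz
    exact mem_disk.2 (hz.trans_lt (mem_disk.1 hz₁))
  set K : Set ℂ := closedBall (0 : ℂ) ‖z₁‖ ∩ (fun z => ‖ω z‖) ⁻¹' Ici 1 with hK
  have hKc : IsCompact K :=
    (isCompact_closedBall (0 : ℂ) ‖z₁‖).of_isClosed_subset
      ((hω.continuousOn.mono hsub).norm.preimage_isClosed_of_isClosed isClosed_closedBall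
        isClosed_Ici) inter_subset_left
  obtain ⟨z, hzK, hmin⟩ := hKc.exists_isMinOn ⟨z₁, by simp [hK, hcon]⟩ continuous_norm.continuousOn
  have hz1 : 1 ≤ ‖ω z‖ := hzK.2
  have hzd : z ∈ disk := hsub hzK.1
  have hzle : ‖z‖ ≤ ‖z₁‖ := mem_closedBall_zero_iff.1 hzK.1
  have hlt : ∀ w : ℂ, ‖w‖ < ‖z‖ → ‖ω w‖ < 1 := by
    intro w hw
    by_contra hc
    exact absurd (hmin (show w ∈ K from ⟨mem_closedBall_zero_iff.2 (hw.le.trans hzle),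
      not_lt.1 hc⟩)) (not_le.2 hw)
  have hz0 : z ≠ 0 := by
    rintro rfl
    rw [h0, norm_zero] at hz1
    linarith
  have hzpos : 0 < ‖z‖ := norm_pos_iff.2 hz0
  have hmuld : ∀ ζ : ℂ, ‖ζ‖ ≤ 1 → ζ * z ∈ disk := by
    intro ζ hζ
    rw [mem_disk, norm_mul] at *
    nlinarith [norm_nonneg ζ]
  have hUd : DifferentiableOn ℂ (fun ζ : ℂ => ω (ζ * z)) (ball 0 1) :=
    hω.comp (differentiable_id.mul_const z).differentiableOn fun ζ hζ =>
      hmuld ζ (mem_ball_zero_iff.1 hζ).le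
  have hschwarz : ∀ ζ : ℂ, ‖ζ‖ < 1 → ‖ω (ζ * z)‖ ≤ ‖ζ‖ := by
    intro ζ hζ
    refine Complex.norm_le_norm_of_mapsTo_ball hUd (fun ξ hξ => ?_) (by simp [h0]) hζ
    rw [mem_closedBall_zero_iff]
    rw [mem_ball_zero_iff] at hξ
    refine (hlt _ ?_).le
    rw [norm_mul]
    nlinarith
  have hbd : ∀ ζ : ℂ, ‖ζ‖ = 1 → ‖ω (ζ * z)‖ ≤ 1 := by
    intro ζ hζ
    have hc : ContinuousAt (fun t : ℝ => ‖ω ((t * ζ) * z)‖) 1 := by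
      refine ContinuousAt.norm (ContinuousAt.comp (g := ω) ?_ (by fun_prop))
      refine (hω.hasDerivAt_disk (hmuld _ ?_)).continuousAt
      simp [hζ]
    have ht : Tendsto (fun t : ℝ => ‖ω ((t * ζ) * z)‖) (𝓝[<] 1) (𝓝 ‖ω (ζ * z)‖) := by
      have := hc.tendsto.mono_left (nhdsWithin_le_nhds (s := Iio 1))
      simpa using this
    refine le_of_tendsto ht ?_
    filter_upwards [Ioo_mem_nhdsLT (show (0 : ℝ) < 1 by norm_num)] with t ht
    have hn : ‖(t : ℂ) * ζ‖ = t := by simp [hζ, abs_of_pos ht.1]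
    exact (hschwarz _ (by rw [hn]; exact ht.2)).trans (by rw [hn]; exact ht.2.le)
  have hone : ‖ω z‖ = 1 := le_antisymm (by simpa using hbd 1 (by simp)) hz1
  have hωz : ω z ≠ 0 := by rw [← norm_pos_iff, hone]; exact one_pos
  have hzder := hω.hasDerivAt_disk hzd
  set q := z * deriv ω z / ω z with hq
  have hretle : ∀ w : ℂ, (w / ω z).re ≤ ‖w‖ := by
    intro w
    refine (Complex.re_le_norm _).trans ?_
    rw [norm_div, hone, div_one]
  -- `|ω (t z)| ≤ t` for `t < 1`, by the Schwarz lemma, with equality at `t = 1`, so the derivative in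
  -- the radial direction is at least `1`.
  have hrad : 1 ≤ q.re := by
    have hd1 : HasDerivAt (fun t : ℝ => (ω ((t : ℂ) * z) / ω z).re) q.re 1 := by
      have h1 : HasDerivAt (fun t : ℝ => (t : ℂ) * z) z 1 := by
        simpa using (hasDerivAt_id (1 : ℝ)).ofReal_comp.mul_const z
      have h2 : HasDerivAt ω (deriv ω z) (((1 : ℝ) : ℂ) * z) := by simpa using hzder
      have h3 := (h2.comp (1 : ℝ) h1).div_const (ω z)
      have h4 := Complex.reCLM.hasFDerivAt.comp_hasDerivAt (1 : ℝ) h3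
      exact h4.congr_deriv (by rw [hq, mul_comm z]; rfl)
    have hs := (hasDerivAt_iff_tendsto_slope.1 hd1).mono_left
      (nhdsWithin_mono (1 : ℝ) (show Iio (1 : ℝ) ⊆ {1}ᶜ from fun t ht => ne_of_lt ht))
    refine ge_of_tendsto hs ?_
    filter_upwards [Ioo_mem_nhdsLT (show (0 : ℝ) < 1 by norm_num)] with t ht
    rw [slope_def_field, Complex.ofReal_one, one_mul, div_self hωz, Complex.one_re,
      le_div_iff_of_neg (by linarith [ht.2])]
    have hn : ‖(t : ℂ)‖ = t := by simp [abs_of_pos ht.1]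
    have := (hretle (ω (t * z))).trans (hschwarz t (by rw [hn]; exact ht.2))
    rw [hn] at this
    linarith
  -- On the circle through `z` the function `Re (ω / ω z)` is maximal at `z`, so the derivative in the
  -- tangential direction vanishes.
  have hang : q.im = 0 := by
    have hd1 : HasDerivAt (fun τ : ℝ => (ω (Complex.exp (τ * Complex.I) * z) / ω z).re)
        (-q.im) 0 := by
      have h1 : HasDerivAt (fun τ : ℝ => Complex.exp (τ * Complex.I) * z) (Complex.I * z) 0 := by
        have := (((hasDerivAt_id (0 : ℝ)).ofReal_comp.mul_const Complex.I).cexp).mul_const z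
        exact this.congr_deriv (by simp)
      have h2 : HasDerivAt ω (deriv ω z) (Complex.exp (((0 : ℝ) : ℂ) * Complex.I) * z) := by
        simpa using hzder
      have h3 := (h2.comp (0 : ℝ) h1).div_const (ω z)
      have h4 := Complex.reCLM.hasFDerivAt.comp_hasDerivAt (0 : ℝ) h3
      refine h4.congr_deriv ?_
      have : deriv ω z * (Complex.I * z) / ω z = Complex.I * q := by rw [hq]; ring
      rw [this, Complex.reCLM_apply, Complex.I_mul_re]
    have hmax : IsLocalMax (fun τ : ℝ => (ω (Complex.exp (τ * Complex.I) * z) / ω z).re) 0 := by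
      refine Filter.Eventually.of_forall fun τ => ?_
      refine (hretle _).trans ((hbd _ (Complex.norm_exp_ofReal_mul_I τ)).trans ?_)
      simp [div_self hωz]
    have := hmax.hasDerivAt_eq_zero hd1
    linarith
  refine h z hzd q.re hrad hone ?_
  have : ((q.re : ℝ) : ℂ) = q := by
    apply Complex.ext <;> simp [hang]
  rw [this, hq]
  field_simp

/-! ### The planar bound and the sheets of the logarithm -/

theorem mul_dslope_zero {h : ℂ → ℂ} (h0 : h 0 = 0) (z : ℂ) : z * dslope h 0 z = h z := by
  simpa using sub_smul_dslope_of_zero h0 z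

theorem deriv_eq_dslope_add {h : ℂ → ℂ} (hh : DifferentiableOn ℂ h disk) (h0 : h 0 = 0)
    {z : ℂ} (hz : z ∈ disk) : deriv h z = dslope h 0 z + z * deriv (dslope h 0) z := by
  have h1 : h = fun z => z * dslope h 0 z := funext fun z => (mul_dslope_zero h0 z).symm
  have h2 := ((hasDerivAt_id z).mul ((hh.dslope_disk zero_mem_disk).hasDerivAt_disk hz)).deriv
  rw [one_mul] at h2
  exact (congrArg (fun F => deriv F z) h1).trans h2

theorem dslope_ne_zero {h : ℂ → ℂ} (hinj : InjOn h disk) (hd : ∀ z ∈ disk, deriv h z ≠ 0)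
    {a z : ℂ} (ha : a ∈ disk) (hz : z ∈ disk) : dslope h a z ≠ 0 := by
  rcases eq_or_ne z a with rfl | hne
  · rw [dslope_same]
    exact hd z hz
  · rw [dslope_of_ne _ hne, slope_def_field]
    exact div_ne_zero (sub_ne_zero.2 fun h => hne (hinj hz ha h)) (sub_ne_zero.2 hne)

/-- The first half of the Marx–Strohhäcker theorem: a normalized convex function `h` is starlike of
order `1 / 2`, that is `Re (z h' / h) > 1 / 2`, written as `|1 - h / (z h')| < 1`. -/
theorem IsConvexUnivalent.norm_one_sub_dslope_div_lt {h : ℂ → ℂ} (hh : IsConvexUnivalent h)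
    (hd : ∀ z ∈ disk, deriv h z ≠ 0) (h0 : h 0 = 0) :
    ∀ z ∈ disk, ‖1 - dslope h 0 z / deriv h z‖ < 1 := by
  have hhd := hh.1
  have hsd := hhd.dslope_disk zero_mem_disk
  refine norm_lt_one_of_jack (ω := fun z => 1 - dslope h 0 z / deriv h z)
    ((hsd.div hhd.deriv_disk hd).const_sub 1) ?_ ?_
  · rw [dslope_same, div_self (hd 0 zero_mem_disk), sub_self]
  · intro z hz m hm hnorm hjack
    have hdz := hd z hz
    have hs0 := dslope_ne_zero hh.2.1 hd zero_mem_disk hz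
    have hder := (((hsd.hasDerivAt_disk hz).div (hhd.deriv_disk.hasDerivAt_disk hz)
      hdz).const_sub 1).deriv
    have hder : deriv (fun z => 1 - dslope h 0 z / deriv h z) z = _ := hder
    rw [hder] at hjack
    have hprod := deriv_eq_dslope_add hhd h0 hz
    have hc := hh.re_one_add_pos hd hz
    set c := 1 + z * (deriv (deriv h) z / deriv h z) with hcdef
    set s := dslope h 0 z with hs
    set ω := 1 - s / deriv h z with hω
    have key : c * (1 - ω) = 1 + m * ω := by
      rw [← hjack, hcdef, hω]
      field_simp
      linear_combination -deriv h z * hprod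
    have hω1 : 1 - ω ≠ 0 := by
      rw [hω, sub_sub_cancel]
      exact div_ne_zero hs0 hdz
    have hsq : ω.re * ω.re + ω.im * ω.im = 1 := by
      rw [← Complex.normSq_apply, Complex.normSq_eq_norm_sq, hnorm, one_pow]
    have hpos : 0 < (1 - ω.re) := by
      by_contra hcon
      apply hω1
      have h1 : ω.re = 1 := by nlinarith [mul_self_nonneg ω.im]
      have h2 : ω.im = 0 := by rw [h1] at hsq; nlinarith
      apply Complex.ext <;> simp [h1, h2]
    have hre := congrArg Complex.re key
    have him := congrArg Complex.im key
    simp at hre him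
    have hmain : c.re * (2 * (1 - ω.re)) = (1 - m) * (1 - ω.re) := by
      linear_combination (1 - ω.re) * hre - ω.im * him - (c.re + m) * hsq
    nlinarith [mul_nonneg (sub_nonneg.2 hm) hpos.le, mul_pos hc hpos]

/-- The second half of the Marx–Strohhäcker theorem: `Re (h z / z) > 1 / 2` for a normalized convex
function `h`, written as `|z / h z - 1| < 1`. -/
theorem IsConvexUnivalent.norm_one_sub_inv_dslope_lt {h : ℂ → ℂ} (hh : IsConvexUnivalent h)
    (hd : ∀ z ∈ disk, deriv h z ≠ 0) (h0 : h 0 = 0) (h1 : deriv h 0 = 1) :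
    ∀ z ∈ disk, ‖1 - (dslope h 0 z)⁻¹‖ < 1 := by
  have hhd := hh.1
  have hsd := hhd.dslope_disk zero_mem_disk
  have hs0 : ∀ z ∈ disk, dslope h 0 z ≠ 0 := fun z hz =>
    dslope_ne_zero hh.2.1 hd zero_mem_disk hz
  refine norm_lt_one_of_jack (ω := fun z => 1 - (dslope h 0 z)⁻¹) ((hsd.inv hs0).const_sub 1) ?_ ?_
  · rw [dslope_same, h1, inv_one, sub_self]
  · intro z hz m hm hnorm hjack
    have hdz := hd z hz
    have hsz := hs0 z hz
    have hder : deriv (fun z => 1 - (dslope h 0 z)⁻¹) z = _ :=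
      (((hsd.hasDerivAt_disk hz).inv hsz).const_sub 1).deriv
    rw [hder] at hjack
    have hprod := deriv_eq_dslope_add hhd h0 hz
    have hstar := hh.norm_one_sub_dslope_div_lt hd h0 z hz
    set s := dslope h 0 z with hs
    have key : deriv h z / s = 1 + m * (s - 1) := by
      field_simp at hjack ⊢
      linear_combination hjack + hprod
    have hsre : s.re = 1 / 2 := by
      have h2 : ‖s - 1‖ = ‖s‖ := by
        have : s - 1 = s * (1 - s⁻¹) := by field_simp
        rw [this, norm_mul, hnorm, mul_one]
      have h3 : Complex.normSq (s - 1) = Complex.normSq s := by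
        rw [Complex.normSq_eq_norm_sq, Complex.normSq_eq_norm_sq, h2]
      simp [Complex.normSq_apply] at h3
      nlinarith
    have hσre : 1 / 2 < (deriv h z / s).re := by
      set σ := deriv h z / s with hσ
      have hσ0 : σ ≠ 0 := div_ne_zero hdz hsz
      have h2 : ‖σ - 1‖ < ‖σ‖ := by
        have h4 : σ - 1 = σ * (1 - s / deriv h z) := by
          rw [hσ]; field_simp
        rw [h4, norm_mul]
        exact mul_lt_of_lt_one_right (norm_pos_iff.2 hσ0) hstar
      have h3 : Complex.normSq (σ - 1) < Complex.normSq σ := by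
        rw [Complex.normSq_eq_norm_sq, Complex.normSq_eq_norm_sq]
        exact pow_lt_pow_left₀ h2 (norm_nonneg _) two_ne_zero
      simp [Complex.normSq_apply] at h3
      nlinarith
    rw [key] at hσre
    simp at hσre
    rw [hsre] at hσre
    nlinarith

theorem deriv_ne_zero_of_re_pos {f g : ℂ → ℂ}
    (hre : ∀ z ∈ disk, 0 < (deriv f z / deriv g z).re) : ∀ z ∈ disk, deriv g z ≠ 0 := by
  intro z hz h
  have := hre z hz
  simp [h] at this

theorem re_dslope_div_pos {f g : ℂ → ℂ} (hf : DifferentiableOn ℂ f disk)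
    (hg : IsConvexUnivalent g) (hre : ∀ z ∈ disk, 0 < (deriv f z / deriv g z).re) {a z : ℂ}
    (ha : a ∈ disk) (hz : z ∈ disk) : 0 < (dslope f a z / dslope g a z).re := by
  rcases eq_or_ne z a with rfl | hne
  · rw [dslope_same, dslope_same]
    exact hre z hz
  · rw [dslope_of_ne _ hne, dslope_of_ne _ hne, slope_def_field, slope_def_field,
      div_div_div_cancel_right₀ (sub_ne_zero.2 hne)]
    exact re_div_sub_pos hf hg hre ha hz hne

/-- The normalization of a convex function: value `0` and derivative `1` at the origin. -/
noncomputable def normalization (g : ℂ → ℂ) (z : ℂ) : ℂ :=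
  (deriv g 0)⁻¹ * g z + -((deriv g 0)⁻¹ * g 0)

theorem hasDerivAt_normalization {g : ℂ → ℂ} (hg : DifferentiableOn ℂ g disk) {z : ℂ}
    (hz : z ∈ disk) : HasDerivAt (normalization g) ((deriv g 0)⁻¹ * deriv g z) z :=
  ((hg.hasDerivAt_disk hz).const_mul _).add_const _

theorem normalization_zero (g : ℂ → ℂ) : normalization g 0 = 0 := by simp [normalization]

theorem IsConvexUnivalent.norm_one_sub_inv_dslope_normalization_lt {g : ℂ → ℂ}
    (hg : IsConvexUnivalent g) (hd : ∀ z ∈ disk, deriv g z ≠ 0) :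
    ∀ z ∈ disk, ‖1 - (dslope (normalization g) 0 z)⁻¹‖ < 1 := by
  have hc := hd 0 zero_mem_disk
  refine IsConvexUnivalent.norm_one_sub_inv_dslope_lt (hg.const_mul_add (inv_ne_zero hc) _) ?_
    (normalization_zero g) ?_
  · intro z hz
    have := (hasDerivAt_normalization hg.1 hz).deriv
    exact this ▸ mul_ne_zero (inv_ne_zero hc) (hd z hz)
  · rw [(hasDerivAt_normalization hg.1 zero_mem_disk).deriv, inv_mul_cancel₀ hc]

/-- The sharp planar bound `|z / f z - 1| < 3` for close-to-convex functions. With `h` the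
normalized convex function and `Q` the difference quotient of `f` over `g` based at `z`, which has
positive real part, differentiation of `Q * (g - g z) = f - f z` at the origin gives
`z / f z = z / h z - z * Q' 0 / Q 0`. The first term lies within `1` of the point `1`, and the
second has modulus below `2`. -/
theorem norm_div_sub_one_lt {f g : ℂ → ℂ} (hf : DifferentiableOn ℂ f disk) (hf0 : f 0 = 0)
    (hf1 : deriv f 0 = 1) (hg : IsConvexUnivalent g)
    (hre : ∀ z ∈ disk, 0 < (deriv f z / deriv g z).re) {z : ℂ} (hz : z ∈ disk) (hz0 : z ≠ 0) :
    f z ≠ 0 ∧ ‖z / f z - 1‖ < 3 := by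
  have hd := deriv_ne_zero_of_re_pos hre
  have hc := hd 0 zero_mem_disk
  have hG : g z - g 0 ≠ 0 := sub_ne_zero.2 fun h => hz0 (hg.2.1 hz zero_mem_disk h)
  have hq := hg.norm_one_sub_inv_dslope_normalization_lt hd z hz
  set Q : ℂ → ℂ := fun x => dslope f z x / dslope g z x with hQ
  have hQd : DifferentiableOn ℂ Q disk := (hf.dslope_disk hz).div (hg.1.dslope_disk hz)
    fun x hx => dslope_ne_zero hg.2.1 hd hz hx
  have hQre : ∀ x ∈ disk, 0 < (Q x).re := fun x hx => re_dslope_div_pos hf hg hre hz hx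
  have hQ0 : Q 0 ≠ 0 := by
    intro h
    have := hQre 0 zero_mem_disk
    simp [h] at this
  have hmul : ∀ x ∈ disk, Q x * (g x - g z) = f x - f z := by
    intro x hx
    have h1 := sub_smul_dslope f z x
    have h2 := sub_smul_dslope g z x
    have h3 := dslope_ne_zero hg.2.1 hd hz hx
    rw [← h1, ← h2, hQ]
    simp only [smul_eq_mul]
    field_simp
  have hf_eq : f z = Q 0 * (g z - g 0) := by
    have := hmul 0 zero_mem_disk
    rw [hf0] at this
    linear_combination this
  have hder : deriv Q 0 * (g 0 - g z) + Q 0 * deriv g 0 = 1 := by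
    have h1 := ((hQd.hasDerivAt_disk zero_mem_disk).mul
      ((hg.1.hasDerivAt_disk zero_mem_disk).sub_const (g z))).deriv
    have h2 : (Q * fun x => g x - g z) =ᶠ[𝓝 0] fun x => f x - f z :=
      Filter.eventually_of_mem (disk_mem_nhds zero_mem_disk) hmul
    rw [h2.deriv_eq, ((hf.hasDerivAt_disk zero_mem_disk).sub_const (f z)).deriv, hf1] at h1
    exact h1.symm
  have hfz : f z ≠ 0 := by
    rw [hf_eq]
    exact mul_ne_zero hQ0 hG
  have hqeq : (dslope (normalization g) 0 z)⁻¹ = z * deriv g 0 / (g z - g 0) := by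
    have : slope (normalization g) 0 z = (g z - g 0) / (z * deriv g 0) := by
      rw [slope_def_field, normalization_zero, normalization]
      field_simp
      ring
    rw [dslope_of_ne _ hz0, this, inv_div]
  have hsplit : z / f z - 1 = -(1 - (dslope (normalization g) 0 z)⁻¹) - z * (deriv Q 0 / Q 0) := by
    rw [hqeq, hf_eq]
    field_simp
    linear_combination -z * hder
  have hcar := norm_deriv_le_two_mul_re hQd hQre
  have hX : ‖z * (deriv Q 0 / Q 0)‖ ≤ 2 := by
    have h1 : ‖deriv Q 0 / Q 0‖ ≤ 2 := by
      rw [norm_div, div_le_iff₀ (norm_pos_iff.2 hQ0)]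
      linarith [Complex.re_le_norm (Q 0)]
    rw [norm_mul]
    have := (mem_disk.1 hz).le
    nlinarith [norm_nonneg z, norm_nonneg (deriv Q 0 / Q 0)]
  refine ⟨hfz, ?_⟩
  rw [hsplit]
  refine (norm_sub_le _ _).trans_lt ?_
  rw [norm_neg]
  linarith

/-- A close-to-convex function is `z * (s z * M z)`, where `z * s z` is the normalized convex
function and `M` has values in a half-plane that contains `1` and has the origin on its boundary.
Along the segment from the convex function to `f` the class is not left, so the planar bound holds
for all intermediate values `s z * (1 - τ + τ * M z)`. -/
theorem exists_factorization {f : ℂ → ℂ} (hf : f ∈ closeToConvex) :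
    ∃ s M : ℂ → ℂ, DifferentiableOn ℂ s disk ∧ DifferentiableOn ℂ M disk ∧ s 0 = 1 ∧ M 0 = 1 ∧
      ∀ z ∈ disk, f z = z * (s z * M z) ∧ 0 < (s z).re ∧ M z ∈ Complex.slitPlane ∧
        ∀ τ ∈ Icc (0 : ℝ) 1, s z * (1 - τ + τ * M z) ≠ 0 ∧
          ‖(s z * (1 - τ + τ * M z))⁻¹ - 1‖ < 3 := by
  obtain ⟨hfd, hf0, hf1, g, hg, hre⟩ := hf
  have hd := deriv_ne_zero_of_re_pos hre
  have hc := hd 0 zero_mem_disk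
  have hhder : ∀ z ∈ disk, HasDerivAt (normalization g) ((deriv g 0)⁻¹ * deriv g z) z :=
    fun z hz => hasDerivAt_normalization hg.1 hz
  have hhd : DifferentiableOn ℂ (normalization g) disk := fun z hz =>
    (hhder z hz).differentiableAt.differentiableWithinAt
  set s := dslope (normalization g) 0 with hs
  have hsd : DifferentiableOn ℂ s disk := hhd.dslope_disk zero_mem_disk
  have hh0 := normalization_zero g
  have hsh : ∀ z, z * s z = normalization g z := mul_dslope_zero hh0
  have hs1 : s 0 = 1 := by
    rw [hs, dslope_same, (hhder 0 zero_mem_disk).deriv, inv_mul_cancel₀ hc]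
  have hsre : ∀ z ∈ disk, 0 < (s z).re := by
    intro z hz
    have h1 := hg.norm_one_sub_inv_dslope_normalization_lt hd z hz
    rw [← hs] at h1
    have h2 : 0 < ((s z)⁻¹).re := by
      have := (Complex.re_le_norm _).trans_lt h1
      rw [Complex.sub_re, Complex.one_re] at this
      linarith
    rw [Complex.inv_re] at h2
    by_contra hcon
    exact absurd h2 (not_lt.2 (div_nonpos_of_nonpos_of_nonneg (not_lt.1 hcon)
      (Complex.normSq_nonneg _)))
  have hs0 : ∀ z ∈ disk, s z ≠ 0 := by
    intro z hz h
    have := hsre z hz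
    simp [h] at this
  have hM1 : dslope f 0 0 / s 0 = 1 := by rw [dslope_same, hf1, hs1, div_one]
  have hfac : ∀ z ∈ disk, f z = z * (s z * (dslope f 0 z / s z)) := by
    intro z hz
    rw [mul_div_cancel₀ _ (hs0 z hz), mul_dslope_zero hf0]
  refine ⟨s, fun z => dslope f 0 z / s z, hsd, (hfd.dslope_disk zero_mem_disk).div hsd hs0, hs1,
    hM1, fun z hz => ⟨hfac z hz, hsre z hz, ?_, ?_⟩⟩
  · have hgs : dslope g 0 z = deriv g 0 * s z := by
      rcases eq_or_ne z 0 with rfl | hz0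
      · rw [dslope_same, hs1, mul_one]
      · rw [hs, dslope_of_ne _ hz0, dslope_of_ne _ hz0, slope_def_field, slope_def_field, hh0,
          normalization]
        field_simp
        ring
    have hQ := re_dslope_div_pos hfd hg hre zero_mem_disk hz
    have hc' := hre 0 zero_mem_disk
    rw [hf1, one_div] at hc'
    rw [hgs, mul_comm (deriv g 0), ← div_div, div_eq_mul_inv] at hQ
    set M := dslope f 0 z / s z
    by_contra hcon
    rw [Complex.mem_slitPlane_iff, not_or, not_lt, not_not] at hcon
    rw [Complex.mul_re, hcon.2, zero_mul, sub_zero] at hQ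
    nlinarith [hcon.1]
  · intro τ hτ
    rcases eq_or_ne z 0 with rfl | hz0
    · have : (1 : ℂ) - τ + τ * 1 = 1 := by ring
      dsimp only
      rw [hM1, hs1, this]
      norm_num
    · set F : ℂ → ℂ := fun x => (1 - τ) * normalization g x + τ * f x with hF
      have hFder : ∀ x ∈ disk, HasDerivAt F
          ((1 - τ) * ((deriv g 0)⁻¹ * deriv g x) + τ * deriv f x) x := fun x hx =>
        ((hhder x hx).const_mul _).add ((hfd.hasDerivAt_disk hx).const_mul _)
      have hFre : ∀ x ∈ disk, 0 < (deriv F x / deriv g x).re := by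
        intro x hx
        have hdx := hd x hx
        have e : deriv F x / deriv g x
            = ((1 - τ : ℝ) : ℂ) * (deriv f 0 / deriv g 0) + (τ : ℂ) * (deriv f x / deriv g x) := by
          rw [(hFder x hx).deriv, hf1]
          push_cast
          field_simp
        rw [e, Complex.add_re, Complex.re_ofReal_mul, Complex.re_ofReal_mul]
        have h1 := hre 0 zero_mem_disk
        have h2 := hre x hx
        rcases hτ.1.eq_or_lt with h | h
        · rw [← h]; simpa using h1
        · exact add_pos_of_nonneg_of_pos (mul_nonneg (by linarith [hτ.2]) h1.le) (mul_pos h h2)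
      have hFz := norm_div_sub_one_lt (f := F) (g := g)
        (fun x hx => (hFder x hx).differentiableAt.differentiableWithinAt)
        (by simp [hF, hh0, hf0])
        (by rw [(hFder 0 zero_mem_disk).deriv, inv_mul_cancel₀ hc, hf1]; ring) hg hFre hz hz0
      have hFeq : F z = z * (s z * (1 - τ + τ * (dslope f 0 z / s z))) := by
        have h1 := hfac z hz
        have h2 := hsh z
        simp only [hF]
        linear_combination -(1 - (τ : ℂ)) * h2 + (τ : ℂ) * h1
      rw [hFeq] at hFz
      refine ⟨right_ne_zero_of_mul hFz.1, ?_⟩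
      have : z / (z * (s z * (1 - τ + τ * (dslope f 0 z / s z))))
          = (s z * (1 - τ + τ * (dslope f 0 z / s z)))⁻¹ := by
        rw [div_mul_cancel_left₀ hz0]
      rw [← this]
      exact hFz.2

/-- On the sheet beyond argument `π` the values `f z / z` satisfy `Re < -1 / 2`: the segment from
`s`, in the right half-plane, to `s * M` meets the real axis at a negative value, which by the
planar bound lies to the left of `-1 / 2`. -/
theorem re_mul_lt_of_pi_lt_arg_add_arg {s M : ℂ} (hs : 0 < s.re) (hM : M ∈ Complex.slitPlane)
    (hseg : ∀ τ ∈ Icc (0 : ℝ) 1, s * (1 - τ + τ * M) ≠ 0 ∧ ‖(s * (1 - τ + τ * M))⁻¹ - 1‖ < 3)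
    (harg : Real.pi < s.arg + M.arg) : (s * M).re < -1 / 2 := by
  have hsarg := abs_lt.1 (Complex.abs_arg_lt_pi_div_two_iff.2 (Or.inl hs))
  have hMarg : M.arg < Real.pi := lt_of_le_of_ne (Complex.arg_le_pi M)
    (Complex.mem_slitPlane_iff_arg.1 hM).1
  have hM0 := Complex.slitPlane_ne_zero hM
  have hs0 : s ≠ 0 := by rintro rfl; simp at hs
  have hpi := Real.pi_pos
  have hsim : 0 < s.im := by
    rw [← Complex.norm_mul_sin_arg]
    exact mul_pos (norm_pos_iff.2 hs0) (Real.sin_pos_of_pos_of_lt_pi (by linarith) (by linarith))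
  have hMim : 0 < M.im := by
    rw [← Complex.norm_mul_sin_arg]
    exact mul_pos (norm_pos_iff.2 hM0) (Real.sin_pos_of_pos_of_lt_pi (by linarith) (by linarith))
  have hwim : (s * M).im < 0 := by
    have h1 : (s * M).im = ‖s‖ * ‖M‖ * Real.sin (s.arg + M.arg) := by
      rw [Complex.mul_im, Real.sin_add, ← Complex.norm_mul_cos_arg s, ← Complex.norm_mul_sin_arg s,
        ← Complex.norm_mul_cos_arg M, ← Complex.norm_mul_sin_arg M]
      simp only [Complex.norm_mul_cos_arg, Complex.norm_mul_sin_arg]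
      simp only [← Complex.norm_mul_cos_arg, ← Complex.norm_mul_sin_arg]
      ring
    have h2 : Real.sin (s.arg + M.arg) < 0 := by
      have := Real.sin_pos_of_pos_of_lt_pi (x := s.arg + M.arg - Real.pi) (by linarith)
        (by linarith)
      rw [Real.sin_sub_pi] at this
      linarith
    rw [h1]
    exact mul_neg_of_pos_of_neg (mul_pos (norm_pos_iff.2 hs0) (norm_pos_iff.2 hM0)) h2
  set w := s * M with hw
  have hden : 0 < s.im - w.im := by linarith
  set τ := s.im / (s.im - w.im) with hτ
  have hτ0 : 0 < τ := div_pos hsim hden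
  have hτ1 : τ < 1 := by rw [hτ, div_lt_one hden]; linarith
  have hτmul : τ * (s.im - w.im) = s.im := div_mul_cancel₀ _ hden.ne'
  obtain ⟨hne, hb⟩ := hseg τ ⟨hτ0.le, hτ1.le⟩
  set N : ℂ := 1 - τ + τ * M with hN
  have hsN : s * N = ((1 - τ : ℝ) : ℂ) * s + (τ : ℂ) * w := by
    rw [hN, hw]; push_cast; ring
  set x := (1 - τ) * s.re + τ * w.re with hx
  have hxeq : s * N = (x : ℂ) := by
    rw [hsN]
    apply Complex.ext
    · simp [hx]
    · simp
      linarith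
  have hNim : N.im = τ * M.im := by simp [hN]
  have hxneg : x < 0 := by
    have h1 := congrArg Complex.re hxeq
    have h2 := congrArg Complex.im hxeq
    rw [Complex.mul_re, Complex.ofReal_re] at h1
    rw [Complex.mul_im, Complex.ofReal_im] at h2
    have h3 : N.im * (s.re * s.re + s.im * s.im) = -x * s.im := by
      linear_combination s.re * h2 - s.im * h1
    have h4 : 0 < N.im * (s.re * s.re + s.im * s.im) := by
      rw [hNim]; positivity
    rw [h3] at h4
    nlinarith
  have hxlt : x < -1 / 2 := by
    rw [hxeq] at hb
    have h1 : ‖((x : ℂ))⁻¹ - 1‖ = |x⁻¹ - 1| := by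
      rw [← Complex.ofReal_inv, ← Complex.ofReal_one, ← Complex.ofReal_sub, Complex.norm_real,
        Real.norm_eq_abs]
    rw [h1] at hb
    have h2 := (abs_lt.1 hb).1
    have h3 : x * x⁻¹ = 1 := mul_inv_cancel₀ hxneg.ne
    nlinarith
  rw [hx] at hxlt
  have : 0 < (1 - τ) * s.re := mul_pos (by linarith) hs
  nlinarith

/-- The mirror image of `re_mul_lt_of_pi_lt_arg_add_arg`. -/
theorem re_mul_lt_of_arg_add_arg_lt {s M : ℂ} (hs : 0 < s.re) (hM : M ∈ Complex.slitPlane)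
    (hseg : ∀ τ ∈ Icc (0 : ℝ) 1, s * (1 - τ + τ * M) ≠ 0 ∧ ‖(s * (1 - τ + τ * M))⁻¹ - 1‖ < 3)
    (harg : s.arg + M.arg < -Real.pi) : (s * M).re < -1 / 2 := by
  have hsπ : s.arg ≠ Real.pi := by
    have := abs_lt.1 (Complex.abs_arg_lt_pi_div_two_iff.2 (Or.inl hs))
    linarith [Real.pi_pos]
  have hMπ : M.arg ≠ Real.pi := (Complex.mem_slitPlane_iff_arg.1 hM).1
  have h := re_mul_lt_of_pi_lt_arg_add_arg (s := (starRingEnd ℂ) s) (M := (starRingEnd ℂ) M)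
    (by simpa using hs) (by
      rw [Complex.mem_slitPlane_iff] at *
      simpa using hM) (fun τ hτ => ?_) (by
      rw [Complex.arg_conj, Complex.arg_conj, if_neg hsπ, if_neg hMπ]; linarith)
  · rwa [← map_mul, Complex.conj_re] at h
  · obtain ⟨h1, h2⟩ := hseg τ hτ
    have e : (starRingEnd ℂ) s * (1 - τ + τ * (starRingEnd ℂ) M)
        = (starRingEnd ℂ) (s * (1 - τ + τ * M)) := by simp
    rw [e]
    have e' : ((starRingEnd ℂ) (s * (1 - τ + τ * M)))⁻¹ - 1
        = (starRingEnd ℂ) ((s * (1 - τ + τ * M))⁻¹ - 1) := by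
      rw [map_sub, map_inv₀, map_one]
    rw [e', RCLike.norm_conj]
    exact ⟨(map_ne_zero _).2 h1, h2⟩

/-- The logarithms of the two factors add up to the logarithmic branch. -/
theorem isLogBranch_log_add_log {f s M : ℂ → ℂ} (hs : DifferentiableOn ℂ s disk)
    (hM : DifferentiableOn ℂ M disk) (hs1 : s 0 = 1) (hM1 : M 0 = 1)
    (hfac : ∀ z ∈ disk, f z = z * (s z * M z)) (hsre : ∀ z ∈ disk, 0 < (s z).re)
    (hMs : ∀ z ∈ disk, M z ∈ Complex.slitPlane) :
    IsLogBranch f fun z => Complex.log (s z) + Complex.log (M z) := by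
  have hss : ∀ z ∈ disk, s z ∈ Complex.slitPlane := fun z hz => Or.inl (hsre z hz)
  refine ⟨(hs.clog hss).add (hM.clog hMs), by simp [hs1, hM1], fun z hz hz0 => ?_⟩
  rw [Complex.exp_add, Complex.exp_log (Complex.slitPlane_ne_zero (hss z hz)),
    Complex.exp_log (Complex.slitPlane_ne_zero (hMs z hz)), hfac z hz,
    mul_div_cancel_left₀ _ hz0]

theorem IsLogBranch.eqOn {f L₁ L₂ : ℂ → ℂ} (h₁ : IsLogBranch f L₁) (h₂ : IsLogBranch f L₂) :
    EqOn L₁ L₂ disk := by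
  have hexp : ∀ z ∈ disk, Complex.exp (L₁ z - L₂ z) = 1 := by
    intro z hz
    rcases eq_or_ne z 0 with rfl | hz0
    · simp [h₁.2.1, h₂.2.1]
    · rw [Complex.exp_sub, div_eq_one_iff_eq (Complex.exp_ne_zero _), h₁.2.2 z hz hz0,
        h₂.2.2 z hz hz0]
  have hd : DifferentiableOn ℂ (fun z => L₁ z - L₂ z) disk := h₁.1.sub h₂.1
  have hder : EqOn (deriv fun z => L₁ z - L₂ z) 0 disk := by
    intro z hz
    have h3 := (hd.hasDerivAt_disk hz).cexp
    have h4 : (fun z => Complex.exp (L₁ z - L₂ z)) =ᶠ[𝓝 z] fun _ => 1 :=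
      Filter.eventually_of_mem (disk_mem_nhds hz) hexp
    have h5 := h3.deriv
    rw [h4.deriv_eq, deriv_const, hexp z hz, one_mul] at h5
    exact h5.symm
  intro z hz
  have h6 := isOpen_disk.is_const_of_deriv_eq_zero (convex_ball (0 : ℂ) 1).isPreconnected hd hder
    hz zero_mem_disk
  simpa [h₁.2.1, h₂.2.1, sub_eq_zero] using h6

/-! ### The extremal problem on the boundary and the threshold -/

/-- The logarithm of the modulus of the point with argument `Y` on the circle of centre `1` and
radius `3`. That circle bounds the values of `z / f z`. -/
noncomputable def rimLog (Y : ℝ) : ℝ := Real.log (Real.cos Y + √(Real.cos Y ^ 2 + 8))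

/-- The maximum of `rimLog Y + b * Y` over `0 ≤ Y ≤ π / 2`, in closed form. -/
noncomputable def arcSup (b : ℝ) : ℝ :=
  Real.log (2 * (5 - 4 * b ^ 2 + 3 * √(1 - 8 * b ^ 2)) / (1 + b ^ 2)) / 2 +
    b * Real.arctan (3 * b / √(1 - 8 * b ^ 2))

/-- The maximum of `log (2 cos φ) + b * (φ + π)` over `|φ| < π / 2`, in closed form. It belongs to
the part of the boundary on the line `Re w = -1 / 2`. -/
noncomputable def lineSup (b : ℝ) : ℝ :=
  Real.log 2 - Real.log (1 + b ^ 2) / 2 + b * (Real.arctan b + Real.pi)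

theorem rim_pos (Y : ℝ) : 0 < Real.cos Y + √(Real.cos Y ^ 2 + 8) := by
  have h : |Real.cos Y| < √(Real.cos Y ^ 2 + 8) := by
    rw [← Real.sqrt_sq_eq_abs]
    exact Real.sqrt_lt_sqrt (sq_nonneg _) (by linarith)
  linarith [neg_abs_le (Real.cos Y)]

theorem rimLog_pi : rimLog Real.pi = Real.log 2 := by
  have : √((-1 : ℝ) ^ 2 + 8) = 3 := by
    rw [show (-1 : ℝ) ^ 2 + 8 = 3 ^ 2 by norm_num, Real.sqrt_sq (by norm_num)]
  rw [rimLog, Real.cos_pi, this]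
  norm_num

theorem hasDerivAt_rimLog (Y : ℝ) :
    HasDerivAt rimLog (-Real.sin Y / √(Real.cos Y ^ 2 + 8)) Y := by
  have hpos : (0 : ℝ) < Real.cos Y ^ 2 + 8 := by positivity
  have hs := Real.sqrt_pos.2 hpos
  have h1 := Real.hasDerivAt_cos Y
  have h2 := (h1.add (((h1.pow 2).add_const 8).sqrt hpos.ne')).log (rim_pos Y).ne'
  refine h2.congr_deriv ?_
  have := (rim_pos Y).ne'
  simp only [Pi.add_apply, Pi.pow_apply]
  field_simp
  ring

theorem hasDerivAt_rimLog_add (b Y : ℝ) :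
    HasDerivAt (fun Y => rimLog Y + b * Y) (-Real.sin Y / √(Real.cos Y ^ 2 + 8) + b) Y := by
  exact ((hasDerivAt_rimLog Y).add ((hasDerivAt_id Y).const_mul b)).congr_deriv (by simp)

theorem rimLog_deriv_nonneg {b Y : ℝ} (hb : 0 ≤ b)
    (h : Real.sin Y ^ 2 * (1 + b ^ 2) ≤ 9 * b ^ 2) :
    0 ≤ -Real.sin Y / √(Real.cos Y ^ 2 + 8) + b := by
  have hs : 0 < √(Real.cos Y ^ 2 + 8) := Real.sqrt_pos.2 (by positivity)
  have h1 : Real.sin Y ≤ b * √(Real.cos Y ^ 2 + 8) := by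
    refine le_of_sq_le_sq ?_ (by positivity)
    rw [mul_pow, Real.sq_sqrt (by positivity)]
    nlinarith [Real.sin_sq_add_cos_sq Y]
  have h2 : Real.sin Y / √(Real.cos Y ^ 2 + 8) ≤ b := by rwa [div_le_iff₀ hs]
  rw [neg_div]
  linarith

theorem rimLog_deriv_nonpos {b Y : ℝ} (hY : 0 ≤ Real.sin Y)
    (h : 9 * b ^ 2 ≤ Real.sin Y ^ 2 * (1 + b ^ 2)) :
    -Real.sin Y / √(Real.cos Y ^ 2 + 8) + b ≤ 0 := by
  have hs : 0 < √(Real.cos Y ^ 2 + 8) := Real.sqrt_pos.2 (by positivity)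
  have h1 : b * √(Real.cos Y ^ 2 + 8) ≤ Real.sin Y := by
    refine le_of_sq_le_sq ?_ hY
    rw [mul_pow, Real.sq_sqrt (by positivity)]
    nlinarith [Real.sin_sq_add_cos_sq Y]
  have h2 : b ≤ Real.sin Y / √(Real.cos Y ^ 2 + 8) := by rwa [le_div_iff₀ hs]
  rw [neg_div]
  linarith

section CriticalAngle

variable {b : ℝ}

theorem sqrt_disc_pos (hb : 8 * b ^ 2 < 1) : 0 < √(1 - 8 * b ^ 2) :=
  Real.sqrt_pos.2 (by linarith)

theorem one_add_critical_sq (hb : 8 * b ^ 2 < 1) :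
    1 + (3 * b / √(1 - 8 * b ^ 2)) ^ 2 = (1 + b ^ 2) / √(1 - 8 * b ^ 2) ^ 2 := by
  have hR := sqrt_disc_pos hb
  have hsq : √(1 - 8 * b ^ 2) ^ 2 = 1 - 8 * b ^ 2 := Real.sq_sqrt (by linarith)
  rw [div_pow, eq_div_iff (by positivity), add_mul, div_mul_cancel₀ _ (by positivity), hsq]
  ring

theorem cos_critical (hb : 8 * b ^ 2 < 1) :
    Real.cos (Real.arctan (3 * b / √(1 - 8 * b ^ 2))) = √(1 - 8 * b ^ 2) / √(1 + b ^ 2) := by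
  have hR := sqrt_disc_pos hb
  rw [Real.cos_arctan, one_add_critical_sq hb, Real.sqrt_div (by positivity), Real.sqrt_sq hR.le,
    one_div_div]

theorem sin_critical_sq (hb : 8 * b ^ 2 < 1) :
    Real.sin (Real.arctan (3 * b / √(1 - 8 * b ^ 2))) ^ 2 * (1 + b ^ 2) = 9 * b ^ 2 := by
  have hR := sqrt_disc_pos hb
  rw [Real.sin_sq_arctan, one_add_critical_sq hb]
  generalize √(1 - 8 * b ^ 2) = R at hR
  field_simp
  ring

/-- The modulus at the critical angle of the point on the circle of centre `1` and radius `3`. -/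
theorem rim_critical (hb : 8 * b ^ 2 < 1) :
    Real.cos (Real.arctan (3 * b / √(1 - 8 * b ^ 2))) +
      √(Real.cos (Real.arctan (3 * b / √(1 - 8 * b ^ 2))) ^ 2 + 8) =
        (√(1 - 8 * b ^ 2) + 3) / √(1 + b ^ 2) := by
  have hsq : √(1 - 8 * b ^ 2) ^ 2 = 1 - 8 * b ^ 2 := Real.sq_sqrt (by linarith)
  have h1 : (√(1 - 8 * b ^ 2) / √(1 + b ^ 2)) ^ 2 + 8 = (3 / √(1 + b ^ 2)) ^ 2 := by
    rw [div_pow, div_pow, hsq, Real.sq_sqrt (by positivity)]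
    field_simp
    ring
  rw [cos_critical hb, h1, Real.sqrt_sq (by positivity)]
  ring

theorem rimLog_critical (hb : 8 * b ^ 2 < 1) :
    rimLog (Real.arctan (3 * b / √(1 - 8 * b ^ 2))) +
      b * Real.arctan (3 * b / √(1 - 8 * b ^ 2)) = arcSup b := by
  have hsq : √(1 - 8 * b ^ 2) ^ 2 = 1 - 8 * b ^ 2 := Real.sq_sqrt (by linarith)
  have h1 : 2 * (5 - 4 * b ^ 2 + 3 * √(1 - 8 * b ^ 2)) / (1 + b ^ 2)
      = ((√(1 - 8 * b ^ 2) + 3) / √(1 + b ^ 2)) ^ 2 := by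
    rw [div_pow, Real.sq_sqrt (by positivity)]
    congr 1
    linear_combination -hsq
  rw [arcSup, rimLog, rim_critical hb, h1, Real.log_pow]
  push_cast
  ring

theorem critical_mem (hb0 : 0 ≤ b) :
    0 ≤ Real.arctan (3 * b / √(1 - 8 * b ^ 2)) ∧
      Real.arctan (3 * b / √(1 - 8 * b ^ 2)) < Real.pi / 2 :=
  ⟨Real.arctan_nonneg.2 (by positivity), Real.arctan_lt_pi_div_two _⟩

/-- The function `rimLog Y + b * Y` increases up to the critical angle and decreases from there to the
supplementary angle. -/
theorem rimLog_add_le_arcSup (hb0 : 0 ≤ b) (hb : 8 * b ^ 2 < 1) {Y : ℝ} (hY0 : 0 ≤ Y)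
    (hY : Y ≤ Real.pi - Real.arctan (3 * b / √(1 - 8 * b ^ 2))) :
    rimLog Y + b * Y ≤ arcSup b := by
  obtain ⟨h0, h1⟩ := critical_mem (b := b) hb0
  have hsin := sin_critical_sq hb
  rw [← rimLog_critical hb]
  set c := Real.arctan (3 * b / √(1 - 8 * b ^ 2)) with hc
  have hsc : 0 ≤ Real.sin c := Real.sin_nonneg_of_nonneg_of_le_pi h0 (by linarith)
  rcases le_total Y c with h | h
  · refine monotoneOn_of_deriv_nonneg (convex_Icc 0 c)
      (fun x _ => (hasDerivAt_rimLog_add b x).continuousAt.continuousWithinAt)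
      (fun x _ => (hasDerivAt_rimLog_add b x).differentiableAt.differentiableWithinAt)
      (fun x hx => ?_) ⟨hY0, h⟩ ⟨h0, le_rfl⟩ h
    rw [interior_Icc] at hx
    rw [(hasDerivAt_rimLog_add b x).deriv]
    refine rimLog_deriv_nonneg hb0 ?_
    have h3 : Real.sin x ≤ Real.sin c :=
      Real.sin_le_sin_of_le_of_le_pi_div_two (by linarith [hx.1]) h1.le hx.2.le
    have h4 : 0 ≤ Real.sin x :=
      Real.sin_nonneg_of_nonneg_of_le_pi hx.1.le (by linarith [hx.2])
    rw [← hsin]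
    gcongr
  · refine antitoneOn_of_deriv_nonpos (convex_Icc c (Real.pi - c))
      (fun x _ => (hasDerivAt_rimLog_add b x).continuousAt.continuousWithinAt)
      (fun x _ => (hasDerivAt_rimLog_add b x).differentiableAt.differentiableWithinAt)
      (fun x hx => ?_) ⟨le_rfl, h.trans hY⟩ ⟨h, hY⟩ h
    rw [interior_Icc] at hx
    rw [(hasDerivAt_rimLog_add b x).deriv]
    have h3 : Real.sin c ≤ Real.sin x := by
      rcases le_total x (Real.pi / 2) with hx' | hx'
      · exact Real.sin_le_sin_of_le_of_le_pi_div_two (by linarith) hx' hx.1.le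
      · rw [← Real.sin_pi_sub x]
        exact Real.sin_le_sin_of_le_of_le_pi_div_two (by linarith) (by linarith) (by linarith [hx.2])
    refine rimLog_deriv_nonpos (hsc.trans h3) ?_
    rw [← hsin]
    gcongr

/-- Beyond the supplementary angle `rimLog Y + b * Y` increases again, so the endpoint `Y = π`
competes with the critical angle. -/
theorem rimLog_add_le_max (hb0 : 0 ≤ b) (hb : 8 * b ^ 2 < 1) {Y : ℝ} (hY0 : 0 ≤ Y)
    (hY : Y ≤ Real.pi) : rimLog Y + b * Y ≤ max (arcSup b) (Real.log 2 + b * Real.pi) := by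
  obtain ⟨h0, h1⟩ := critical_mem (b := b) hb0
  rcases le_total Y (Real.pi - Real.arctan (3 * b / √(1 - 8 * b ^ 2))) with h | h
  · exact (rimLog_add_le_arcSup hb0 hb hY0 h).trans (le_max_left _ _)
  · refine le_trans ?_ (le_max_right _ _)
    rw [← rimLog_pi]
    have hsin := sin_critical_sq hb
    set c := Real.arctan (3 * b / √(1 - 8 * b ^ 2)) with hc
    refine monotoneOn_of_deriv_nonneg (convex_Icc (Real.pi - c) Real.pi)
      (fun x _ => (hasDerivAt_rimLog_add b x).continuousAt.continuousWithinAt)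
      (fun x _ => (hasDerivAt_rimLog_add b x).differentiableAt.differentiableWithinAt)
      (fun x hx => ?_) ⟨h, hY⟩ ⟨by linarith, le_rfl⟩ hY
    rw [interior_Icc] at hx
    rw [(hasDerivAt_rimLog_add b x).deriv]
    refine rimLog_deriv_nonneg hb0 ?_
    have h3 : Real.sin x ≤ Real.sin c := by
      rw [← Real.sin_pi_sub x]
      exact Real.sin_le_sin_of_le_of_le_pi_div_two (by linarith [hx.2]) h1.le (by linarith [hx.1])
    have h4 : 0 ≤ Real.sin x :=
      Real.sin_nonneg_of_nonneg_of_le_pi (by linarith [hx.1]) hx.2.le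
    rw [← hsin]
    gcongr

end CriticalAngle

/-- For large `b` there is no critical angle, and the endpoint `Y = π` gives the maximum. -/
theorem rimLog_add_le_of_one_le {b : ℝ} (hb0 : 0 ≤ b) (hb : 1 ≤ 8 * b ^ 2) {Y : ℝ} (hY0 : 0 ≤ Y)
    (hY : Y ≤ Real.pi) : rimLog Y + b * Y ≤ Real.log 2 + b * Real.pi := by
  rw [← rimLog_pi]
  refine monotoneOn_of_deriv_nonneg (convex_Icc 0 Real.pi)
    (fun x _ => (hasDerivAt_rimLog_add b x).continuousAt.continuousWithinAt)
    (fun x _ => (hasDerivAt_rimLog_add b x).differentiableAt.differentiableWithinAt)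
    (fun x hx => ?_) ⟨hY0, hY⟩ ⟨Real.pi_pos.le, le_rfl⟩ hY
  rw [(hasDerivAt_rimLog_add b x).deriv]
  refine rimLog_deriv_nonneg hb0 ?_
  nlinarith [Real.sin_sq_le_one x, sq_nonneg b]

theorem log_cos_arctan (b : ℝ) : Real.log (Real.cos (Real.arctan b)) = -(Real.log (1 + b ^ 2) / 2) := by
  rw [Real.cos_arctan, one_div, Real.log_inv, Real.log_sqrt (by positivity)]

theorem lineSup_eq (b : ℝ) : lineSup b =
    Real.log (2 * Real.cos (Real.arctan b)) + b * (Real.arctan b + Real.pi) := by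
  rw [lineSup, Real.log_mul two_ne_zero (Real.cos_arctan_pos b).ne', log_cos_arctan]
  ring

theorem log_two_mul_cos_add_le (b : ℝ) {φ : ℝ} (h1 : -(Real.pi / 2) < φ) (h2 : φ < Real.pi / 2) :
    Real.log (2 * Real.cos φ) + b * (φ + Real.pi) ≤ lineSup b := by
  have hcos : ∀ x ∈ Ioo (-(Real.pi / 2)) (Real.pi / 2), 0 < Real.cos x := fun x hx =>
    Real.cos_pos_of_mem_Ioo hx
  have hder : ∀ x ∈ Ioo (-(Real.pi / 2)) (Real.pi / 2),
      HasDerivAt (fun x => Real.log (2 * Real.cos x) + b * (x + Real.pi)) (-Real.tan x + b) x := by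
    intro x hx
    have hc := hcos x hx
    have h3 := (((Real.hasDerivAt_cos x).const_mul 2).log (by positivity)).add
      (((hasDerivAt_id x).add_const Real.pi).const_mul b)
    refine h3.congr_deriv ?_
    rw [Real.tan_eq_sin_div_cos]
    field_simp
  have htan := Real.tan_arctan b
  obtain ⟨ha1, ha2⟩ := Real.arctan_mem_Ioo b
  rw [lineSup_eq]
  set a := Real.arctan b with ha
  rcases lt_trichotomy φ a with h | h | h
  · obtain ⟨c, hc, hceq⟩ := exists_hasDerivAt_eq_slope
      (fun x => Real.log (2 * Real.cos x) + b * (x + Real.pi)) (fun x => -Real.tan x + b) h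
      (fun x hx => (hder x ⟨by linarith [hx.1], by linarith [hx.2]⟩).continuousAt.continuousWithinAt)
      (fun x hx => hder x ⟨by linarith [hx.1], by linarith [hx.2]⟩)
    rw [eq_div_iff (by linarith)] at hceq
    have := Real.tan_lt_tan_of_lt_of_lt_pi_div_two (by linarith [hc.1]) ha2 hc.2
    nlinarith [mul_pos (sub_pos.2 this) (sub_pos.2 h)]
  · rw [h]
  · obtain ⟨c, hc, hceq⟩ := exists_hasDerivAt_eq_slope
      (fun x => Real.log (2 * Real.cos x) + b * (x + Real.pi)) (fun x => -Real.tan x + b) h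
      (fun x hx => (hder x ⟨by linarith [hx.1], by linarith [hx.2]⟩).continuousAt.continuousWithinAt)
      (fun x hx => hder x ⟨by linarith [hx.1], by linarith [hx.2]⟩)
    rw [eq_div_iff (by linarith)] at hceq
    have := Real.tan_lt_tan_of_lt_of_lt_pi_div_two ha1 (by linarith [hc.2]) hc.1
    nlinarith [mul_pos (sub_pos.2 this) (sub_pos.2 h)]

theorem log_two_add_le_lineSup (b : ℝ) : Real.log 2 + b * Real.pi ≤ lineSup b := by
  have := log_two_mul_cos_add_le b (φ := 0) (by linarith [Real.pi_pos]) (by linarith [Real.pi_pos])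
  simpa using this

/-- `lineSup` grows with slope at least `π` and `arcSup` with slope below `π / 2`, because each is a
maximum of affine functions of `b` with slopes in these ranges. -/
theorem lineSup_sub_arcSup_lt {b c : ℝ} (hb0 : 0 ≤ b) (hbc : b < c) (hc : 8 * c ^ 2 < 1) :
    lineSup b - arcSup b < lineSup c - arcSup c := by
  have hb : 8 * b ^ 2 < 1 := by nlinarith
  obtain ⟨h0, h1⟩ := critical_mem (b := c) (hb0.trans hbc.le)
  have h2 := rimLog_critical hc
  have h3 := rimLog_add_le_arcSup hb0 hb h0
    (by linarith [(critical_mem (b := b) hb0).2])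
  obtain ⟨h4, h5⟩ := Real.arctan_mem_Ioo b
  have h6 := log_two_mul_cos_add_le c h4 h5
  have h7 := lineSup_eq b
  have h8 : 0 ≤ Real.arctan b := Real.arctan_nonneg.2 hb0
  set y := Real.arctan (3 * c / √(1 - 8 * c ^ 2))
  have h9 : (c - b) * y < (c - b) * Real.pi :=
    mul_lt_mul_of_pos_left (by linarith [Real.pi_pos]) (by linarith)
  have h10 : 0 ≤ (c - b) * Real.arctan b := mul_nonneg (by linarith) h8
  linarith

theorem lt_inv_two_sqrt_two_iff {b : ℝ} (hb : 0 ≤ b) : b < 1 / (2 * √2) ↔ 8 * b ^ 2 < 1 := by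
  have h2 : √2 ^ 2 = (2 : ℝ) := Real.sq_sqrt (by norm_num)
  rw [lt_div_iff₀ (by positivity), ← sq_lt_sq₀ (by positivity) (by norm_num), mul_pow, mul_pow, h2]
  constructor <;> intro h <;> linarith

theorem two_mul_lineSup_sub_arcSup {b : ℝ} (hb : 8 * b ^ 2 < 1) :
    2 * (lineSup b - arcSup b) =
      2 * b * (Real.arctan b - Real.arctan (3 * b / √(1 - 8 * b ^ 2)) + Real.pi) -
        (Real.log (5 - 4 * b ^ 2 + 3 * √(1 - 8 * b ^ 2)) - Real.log 2) := by
  have h1 : 0 < 5 - 4 * b ^ 2 + 3 * √(1 - 8 * b ^ 2) := by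
    have := sqrt_disc_pos hb
    nlinarith
  rw [lineSup, arcSup, Real.log_div (by positivity) (by positivity),
    Real.log_mul two_ne_zero h1.ne']
  ring

theorem isThreshold_iff {b : ℝ} :
    IsThreshold b ↔ 0 < b ∧ 8 * b ^ 2 < 1 ∧ lineSup b = arcSup b := by
  constructor
  · rintro ⟨h0, h1, h2⟩
    rw [lt_inv_two_sqrt_two_iff h0.le] at h1
    refine ⟨h0, h1, ?_⟩
    linarith [two_mul_lineSup_sub_arcSup h1]
  · rintro ⟨h0, h1, h2⟩
    refine ⟨h0, (lt_inv_two_sqrt_two_iff h0.le).2 h1, ?_⟩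
    linarith [two_mul_lineSup_sub_arcSup h1]

theorem continuousOn_lineSup_sub_arcSup :
    ContinuousOn (fun b => lineSup b - arcSup b) {b | 8 * b ^ 2 < 1} := by
  have hR : ContinuousOn (fun b : ℝ => √(1 - 8 * b ^ 2)) {b | 8 * b ^ 2 < 1} := by fun_prop
  have h1 : ContinuousOn (fun b : ℝ => 1 + b ^ 2) {b | 8 * b ^ 2 < 1} := by fun_prop
  have h2 : ∀ b ∈ {b : ℝ | 8 * b ^ 2 < 1}, 1 + b ^ 2 ≠ 0 := fun b _ => by positivity
  refine ContinuousOn.sub ?_ (ContinuousOn.add ?_ ?_)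
  · unfold lineSup
    refine ContinuousOn.add (continuousOn_const.sub ((h1.log h2).div_const 2)) ?_
    exact continuousOn_id.mul ((Real.continuous_arctan.continuousOn).add continuousOn_const)
  · refine ContinuousOn.div_const (ContinuousOn.log (ContinuousOn.div ?_ h1 h2) ?_) 2
    · fun_prop
    · intro b hb
      have := sqrt_disc_pos (b := b) hb
      have hb : 8 * b ^ 2 < 1 := hb
      exact (div_pos (by nlinarith) (by positivity)).ne'
  · refine continuousOn_id.mul (Real.continuous_arctan.comp_continuousOn ?_)
    exact ContinuousOn.div (by fun_prop) hR fun b hb => (sqrt_disc_pos hb).ne'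

theorem arctan_le_taylor {u : ℝ} (hu : 0 ≤ u) : Real.arctan u ≤ u - u ^ 3 / 3 + u ^ 5 / 5 := by
  have hder : ∀ x : ℝ, HasDerivAt (fun x => x - x ^ 3 / 3 + x ^ 5 / 5 - Real.arctan x)
      (1 - x ^ 2 + x ^ 4 - 1 / (1 + x ^ 2)) x := by
    intro x
    have h := (((hasDerivAt_id x).sub ((hasDerivAt_pow 3 x).div_const 3)).add
      ((hasDerivAt_pow 5 x).div_const 5)).sub (Real.hasDerivAt_arctan x)
    exact h.congr_deriv (by push_cast; ring)
  have hmono : MonotoneOn (fun x : ℝ => x - x ^ 3 / 3 + x ^ 5 / 5 - Real.arctan x) univ :=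
    monotoneOn_of_deriv_nonneg convex_univ
      (fun x _ => (hder x).continuousAt.continuousWithinAt)
      (fun x _ => (hder x).differentiableAt.differentiableWithinAt) fun x _ => by
        rw [(hder x).deriv]
        have : 1 - x ^ 2 + x ^ 4 - 1 / (1 + x ^ 2) = x ^ 6 / (1 + x ^ 2) := by
          field_simp
          ring
        rw [this]
        positivity
  have := hmono (mem_univ 0) (mem_univ u) hu
  simp at this
  linarith

theorem taylor_le_arctan {u : ℝ} (hu : 0 ≤ u) :
    u - u ^ 3 / 3 + u ^ 5 / 5 - u ^ 7 / 7 ≤ Real.arctan u := by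
  have hder : ∀ x : ℝ,
      HasDerivAt (fun x => Real.arctan x - (x - x ^ 3 / 3 + x ^ 5 / 5 - x ^ 7 / 7))
      (1 / (1 + x ^ 2) - (1 - x ^ 2 + x ^ 4 - x ^ 6)) x := by
    intro x
    have h := (Real.hasDerivAt_arctan x).sub
      ((((hasDerivAt_id x).sub ((hasDerivAt_pow 3 x).div_const 3)).add
      ((hasDerivAt_pow 5 x).div_const 5)).sub ((hasDerivAt_pow 7 x).div_const 7))
    exact h.congr_deriv (by push_cast; ring)
  have hmono : MonotoneOn
      (fun x : ℝ => Real.arctan x - (x - x ^ 3 / 3 + x ^ 5 / 5 - x ^ 7 / 7)) univ :=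
    monotoneOn_of_deriv_nonneg convex_univ
      (fun x _ => (hder x).continuousAt.continuousWithinAt)
      (fun x _ => (hder x).differentiableAt.differentiableWithinAt) fun x _ => by
        rw [(hder x).deriv]
        have : 1 / (1 + x ^ 2) - (1 - x ^ 2 + x ^ 4 - x ^ 6) = x ^ 8 / (1 + x ^ 2) := by
          field_simp
          ring
        rw [this]
        positivity
  have := hmono (mem_univ 0) (mem_univ u) hu
  simp at this
  linarith

theorem arctan_eq_pi_div_four_sub {u : ℝ} (h0 : 0 < 1 + u) :
    Real.arctan ((1 - u) / (1 + u)) = Real.pi / 4 - Real.arctan u := by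
  have hprod : (1 - u) / (1 + u) * u < 1 := by
    rw [div_mul_eq_mul_div, div_lt_one h0]
    nlinarith [sq_nonneg u]
  have h := Real.arctan_add hprod
  have h2 : ((1 - u) / (1 + u) + u) / (1 - (1 - u) / (1 + u) * u) = 1 := by
    have h3 : 1 - (1 - u) / (1 + u) * u ≠ 0 := by linarith
    rw [div_eq_one_iff_eq h3]
    field_simp
    ring
  rw [h2, Real.arctan_one] at h
  linarith

/-- The numerical comparison at `b = 0.24001`. The quotient `3 b / √(1 - 8 b ^ 2)` is close to `1`, so
its arctangent is compared with `arctan b + π / 4 - arctan u`, where `u` is a rational number near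
`0.25`. The argument of the logarithm is close to `125 / 36`, whose logarithm is a combination of
`log 2`, `log 3` and `log 5`. -/
theorem lineSup_lt_arcSup_left : lineSup 0.24001 < arcSup 0.24001 := by
  have hb : 8 * (0.24001 : ℝ) ^ 2 < 1 := by norm_num
  have h := two_mul_lineSup_sub_arcSup hb
  have hR1 : (0.734276 : ℝ) < √(1 - 8 * 0.24001 ^ 2) := Real.lt_sqrt_of_sq_lt (by norm_num)
  have hR2 : √(1 - 8 * 0.24001 ^ 2) < (0.734277 : ℝ) :=
    (Real.sqrt_lt' (by norm_num)).2 (by norm_num)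
  set R := √(1 - 8 * (0.24001 : ℝ) ^ 2) with hR
  have hR0 : 0 < R := by linarith
  have hY : Real.arctan 0.24001 + (Real.pi / 4 - Real.arctan 0.2504)
      ≤ Real.arctan (3 * 0.24001 / R) := by
    rw [← arctan_eq_pi_div_four_sub (by norm_num), Real.arctan_add (by norm_num)]
    refine Real.arctan_mono ?_
    rw [le_div_iff₀ hR0]
    refine (mul_le_mul_of_nonneg_left hR2.le (by norm_num)).trans ?_
    norm_num
  have hT := arctan_le_taylor (u := 0.2504) (by norm_num)
  have hlog : Real.log (125 / 36) + (1 - (125 / 36) / ((5 - 4 * 0.24001 ^ 2 + 3 * 0.734276) / 2))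
      ≤ Real.log (5 - 4 * 0.24001 ^ 2 + 3 * R) - Real.log 2 := by
    have h1 : Real.log ((5 - 4 * 0.24001 ^ 2 + 3 * 0.734276) / 2) ≤
        Real.log (5 - 4 * 0.24001 ^ 2 + 3 * R) - Real.log 2 := by
      rw [← Real.log_div (by nlinarith) two_ne_zero]
      refine Real.log_le_log (by norm_num) ?_
      linarith
    refine le_trans ?_ h1
    have h2 := Real.log_le_sub_one_of_pos
      (show (0 : ℝ) < (125 / 36) / ((5 - 4 * 0.24001 ^ 2 + 3 * 0.734276) / 2) by norm_num)
    rw [Real.log_div (by norm_num) (by norm_num)] at h2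
    linarith
  have hlog' : Real.log (125 / 36) = 3 * Real.log 5 - 2 * Real.log 2 - 2 * Real.log 3 := by
    rw [show (125 / 36 : ℝ) = 5 ^ 3 / (2 ^ 2 * 3 ^ 2) by norm_num,
      Real.log_div (by norm_num) (by norm_num), Real.log_mul (by norm_num) (by norm_num),
      Real.log_pow, Real.log_pow, Real.log_pow]
    push_cast
    ring
  have hpi := Real.pi_lt_d6
  have := Real.log_two_lt_d9
  have := Real.log_three_lt_d9
  have := Real.log_five_gt_d9
  norm_num at hT hlog h hY ⊢
  linarith

/-- The numerical comparison at `b = 0.24002`, with the auxiliary quantities of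
`lineSup_lt_arcSup_left`. -/
theorem arcSup_lt_lineSup_right : arcSup 0.24002 < lineSup 0.24002 := by
  have hb : 8 * (0.24002 : ℝ) ^ 2 < 1 := by norm_num
  have h := two_mul_lineSup_sub_arcSup hb
  have hR1 : (0.734250 : ℝ) < √(1 - 8 * 0.24002 ^ 2) := Real.lt_sqrt_of_sq_lt (by norm_num)
  have hR2 : √(1 - 8 * 0.24002 ^ 2) < (0.734251 : ℝ) :=
    (Real.sqrt_lt' (by norm_num)).2 (by norm_num)
  set R := √(1 - 8 * (0.24002 : ℝ) ^ 2) with hR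
  have hR0 : 0 < R := by linarith
  have hY : Real.arctan (3 * 0.24002 / R) ≤
      Real.arctan 0.24002 + (Real.pi / 4 - Real.arctan 0.25036) := by
    rw [← arctan_eq_pi_div_four_sub (by norm_num), Real.arctan_add (by norm_num)]
    refine Real.arctan_mono ?_
    rw [div_le_iff₀ hR0]
    refine le_trans ?_ (mul_le_mul_of_nonneg_left hR1.le (by norm_num))
    norm_num
  have hT := taylor_le_arctan (u := 0.25036) (by norm_num)
  have hlog : Real.log (5 - 4 * 0.24002 ^ 2 + 3 * R) - Real.log 2 ≤
      Real.log (125 / 36) + (((5 - 4 * 0.24002 ^ 2 + 3 * 0.734251) / 2) / (125 / 36) - 1) := by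
    have h1 : Real.log (5 - 4 * 0.24002 ^ 2 + 3 * R) - Real.log 2 ≤
        Real.log ((5 - 4 * 0.24002 ^ 2 + 3 * 0.734251) / 2) := by
      rw [← Real.log_div (by nlinarith) two_ne_zero]
      refine Real.log_le_log (by nlinarith) ?_
      linarith
    refine h1.trans ?_
    have h2 := Real.log_le_sub_one_of_pos
      (show (0 : ℝ) < ((5 - 4 * 0.24002 ^ 2 + 3 * 0.734251) / 2) / (125 / 36) by norm_num)
    rw [Real.log_div (by norm_num) (by norm_num)] at h2
    linarith
  have hlog' : Real.log (125 / 36) = 3 * Real.log 5 - 2 * Real.log 2 - 2 * Real.log 3 := by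
    rw [show (125 / 36 : ℝ) = 5 ^ 3 / (2 ^ 2 * 3 ^ 2) by norm_num,
      Real.log_div (by norm_num) (by norm_num), Real.log_mul (by norm_num) (by norm_num),
      Real.log_pow, Real.log_pow, Real.log_pow]
    push_cast
    ring
  have hpi := Real.pi_gt_d6
  have := Real.log_two_gt_d9
  have := Real.log_three_gt_d9
  have := Real.log_five_lt_d9
  norm_num at hT hlog h hY ⊢
  linarith

theorem exists_threshold : ∃ b₀ : ℝ, IsThreshold b₀ ∧ 0.24001 ≤ b₀ ∧ b₀ < 0.24002 := by
  have hc : ContinuousOn (fun b => lineSup b - arcSup b) (Icc 0.24001 0.24002) :=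
    continuousOn_lineSup_sub_arcSup.mono fun b hb => by
      have h : 8 * b ^ 2 < 1 := by nlinarith [hb.1, hb.2]
      exact h
  obtain ⟨b, hb, hb0⟩ := intermediate_value_Ico (by norm_num : (0.24001 : ℝ) ≤ 0.24002) hc
    (show (0 : ℝ) ∈ Ico _ _ from ⟨(sub_neg.2 lineSup_lt_arcSup_left).le,
      sub_pos.2 arcSup_lt_lineSup_right⟩)
  refine ⟨b, isThreshold_iff.2 ⟨by linarith [hb.1], by nlinarith [hb.1, hb.2], ?_⟩, hb.1, hb.2⟩
  have hb0 : lineSup b - arcSup b = 0 := hb0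
  linarith

/-! ### Extremal functions -/

/-- The extremal functions of the class, with derivative `(1 - x z) / (1 - y z) ^ 3`. -/
noncomputable def extremalFunction (x y z : ℂ) : ℂ :=
  (z - (x + y) / 2 * z ^ 2) / (1 - y * z) ^ 2

/-- The branch of `log (f z / z)` for the extremal function `f` with parameters `x` and `y`. -/
noncomputable def extremalLog (x y z : ℂ) : ℂ :=
  Complex.log (2 - (x + y) * z) - Complex.log 2 - 2 * Complex.log (1 - y * z)

theorem re_one_sub_mul_pos {x z : ℂ} (hx : ‖x‖ ≤ 1) (hz : z ∈ disk) : 0 < (1 - x * z).re := by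
  rw [mem_disk] at hz
  have h1 := Complex.re_le_norm (x * z)
  rw [norm_mul] at h1
  rw [Complex.sub_re, Complex.one_re]
  nlinarith [norm_nonneg x, norm_nonneg z]

theorem one_sub_mul_ne_zero {x z : ℂ} (hx : ‖x‖ ≤ 1) (hz : z ∈ disk) : 1 - x * z ≠ 0 := by
  intro h
  have := re_one_sub_mul_pos hx hz
  simp [h] at this

theorem hasDerivAt_halfPlaneMap {y z : ℂ} (hy : ‖y‖ ≤ 1) (hz : z ∈ disk) :
    HasDerivAt (fun z => z / (1 - y * z)) (1 / (1 - y * z) ^ 2) z := by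
  have h := (hasDerivAt_id z).div (((hasDerivAt_id z).const_mul y).const_sub 1)
    (one_sub_mul_ne_zero hy hz)
  refine h.congr_deriv ?_
  simp only [id]
  congr 1
  ring

/-- The map `z / (1 - y z)` with `|y| = 1` is convex, with the half-plane `Re (y w) > -1 / 2` as its
image. -/
theorem isConvexUnivalent_halfPlaneMap {y : ℂ} (hy : ‖y‖ = 1) :
    IsConvexUnivalent fun z => z / (1 - y * z) := by
  refine ⟨fun z hz =>
    (hasDerivAt_halfPlaneMap hy.le hz).differentiableAt.differentiableWithinAt, ?_, ?_⟩
  · intro a ha b hb h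
    have h : a / (1 - y * a) = b / (1 - y * b) := h
    rw [div_eq_div_iff (one_sub_mul_ne_zero hy.le ha) (one_sub_mul_ne_zero hy.le hb)] at h
    linear_combination h
  · have himage : (fun z => z / (1 - y * z)) '' disk
        = LinearMap.mulLeft ℝ y ⁻¹' {w : ℂ | -1 / 2 < w.re} := by
      ext w
      simp only [mem_image, mem_preimage, LinearMap.mulLeft_apply, mem_ofPred_eq]
      constructor
      · rintro ⟨z, hz, rfl⟩
        have hne := one_sub_mul_ne_zero hy.le hz
        have hu : ‖y * z‖ < 1 := by rw [norm_mul, hy, one_mul]; exact mem_disk.1 hz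
        rw [mul_div_assoc']
        set u := y * z
        have hpos := Complex.normSq_pos.2 hne
        have hn : Complex.normSq u < 1 := by
          rw [Complex.normSq_eq_norm_sq]; nlinarith [norm_nonneg u]
        rw [Complex.div_re, ← add_div, lt_div_iff₀ hpos]
        simp [Complex.normSq_apply] at hn ⊢
        nlinarith
      · intro hw
        have hlt : Complex.normSq w < Complex.normSq (1 + y * w) := by
          have h1 : Complex.normSq (y * w) = Complex.normSq w := by
            rw [Complex.normSq_mul, Complex.normSq_eq_norm_sq y, hy]; ring
          rw [← h1, Complex.normSq_apply, Complex.normSq_apply, Complex.add_re, Complex.add_im,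
            Complex.one_re, Complex.one_im]
          nlinarith
        have hne : 1 + y * w ≠ 0 := by
          intro h
          rw [h, map_zero] at hlt
          exact absurd hlt (not_lt.2 (Complex.normSq_nonneg w))
        refine ⟨w / (1 + y * w), ?_, ?_⟩
        · rw [mem_disk, norm_div, div_lt_one (norm_pos_iff.2 hne),
            ← sq_lt_sq₀ (norm_nonneg _) (norm_nonneg _), Complex.sq_norm, Complex.sq_norm]
          exact hlt
        · have h1 : 1 - y * (w / (1 + y * w)) = 1 / (1 + y * w) := by
            field_simp
            ring
          rw [h1, div_div_eq_mul_div, div_one, div_mul_cancel₀ _ hne]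
    rw [himage]
    exact (convex_halfSpace_re_gt (-1 / 2)).linear_preimage _

theorem hasDerivAt_extremalFunction {x y z : ℂ} (hy : ‖y‖ ≤ 1) (hz : z ∈ disk) :
    HasDerivAt (extremalFunction x y) ((1 - x * z) / (1 - y * z) ^ 3) z := by
  have hne := one_sub_mul_ne_zero hy hz
  have h := ((hasDerivAt_id z).sub ((hasDerivAt_pow 2 z).const_mul ((x + y) / 2))).div
    ((((hasDerivAt_id z).const_mul y).const_sub 1).pow 2) (pow_ne_zero 2 hne)
  refine h.congr_deriv ?_
  simp only [id, Pi.sub_apply, Pi.pow_apply]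
  rw [div_eq_div_iff (by simpa using hne) (pow_ne_zero 3 hne)]
  push_cast
  ring

/-- The Möbius map `(1 - κ u) / (1 - u)` with `|κ| ≤ 1`, `κ ≠ 1` takes the disk into a half-plane
with the origin on its boundary. -/
theorem re_one_sub_conj_mul_div_pos {κ u : ℂ} (hκ : ‖κ‖ ≤ 1) (hκ1 : κ ≠ 1) (hu : ‖u‖ < 1) :
    0 < ((1 - (starRingEnd ℂ) κ) * (1 - κ * u) / (1 - u)).re := by
  have hne : 1 - u ≠ 0 := by
    intro h
    rw [← sub_eq_zero.1 h] at hu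
    simp at hu
  have hK : Complex.normSq κ ≤ 1 := by
    rw [Complex.normSq_eq_norm_sq]; nlinarith [norm_nonneg κ]
  have hk : κ.re < 1 := by
    refine lt_of_le_of_ne ((Complex.re_le_norm κ).trans hκ) fun h => hκ1 ?_
    rw [Complex.normSq_apply, h] at hK
    apply Complex.ext
    · simp [h]
    · rw [Complex.one_im]; nlinarith
  have hur := Complex.re_le_norm u
  have hun : u.re * u.re + u.im * u.im = ‖u‖ ^ 2 := by
    rw [← Complex.normSq_apply, Complex.normSq_eq_norm_sq]
  have hsq : 0 < 1 - 2 * κ.re + (κ.re * κ.re + κ.im * κ.im) := by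
    nlinarith [sq_nonneg κ.im]
  rw [Complex.normSq_apply] at hK
  rw [Complex.div_re, ← add_div]
  refine div_pos ?_ (Complex.normSq_pos.2 hne)
  simp
  set K := κ.re * κ.re + κ.im * κ.im with hKdef
  set ρ := ‖u‖
  have hρ : 0 ≤ ρ := norm_nonneg u
  have hlin : 0 < (1 - κ.re) - ρ * (κ.re - K) := by
    rcases le_total (κ.re - K) 0 with h | h
    · nlinarith [mul_nonneg hρ (sub_nonneg.2 h)]
    · nlinarith
  have hmain : 0 < (1 - κ.re) + ρ ^ 2 * (κ.re - K) - (1 - K) * u.re := by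
    nlinarith [mul_pos (sub_pos.2 hu) hlin, mul_nonneg (sub_nonneg.2 hK) (sub_nonneg.2 hur)]
  rw [← hun, hKdef] at hmain
  nlinarith

theorem extremalFunction_mem {x y : ℂ} (hx : ‖x‖ ≤ 1) (hy : ‖y‖ = 1) (hxy : x ≠ y) :
    extremalFunction x y ∈ closeToConvex := by
  have hyy : y * (starRingEnd ℂ) y = 1 := by
    rw [Complex.mul_conj, Complex.normSq_eq_norm_sq, hy]; norm_num
  set κ := x * (starRingEnd ℂ) y with hκ
  have hκy : κ * y = x := by rw [hκ]; linear_combination x * hyy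
  have hκ1 : κ ≠ 1 := by
    intro h
    rw [h, one_mul] at hκy
    exact hxy hκy.symm
  have hκn : ‖κ‖ ≤ 1 := by rw [hκ, norm_mul, RCLike.norm_conj, hy, mul_one]; exact hx
  have hc : 1 - (starRingEnd ℂ) κ ≠ 0 := by
    intro h
    apply hκ1
    rw [← Complex.conj_conj κ, ← sub_eq_zero.1 h, map_one]
  refine ⟨fun z hz =>
    (hasDerivAt_extremalFunction hy.le hz).differentiableAt.differentiableWithinAt,
    by simp [extremalFunction], ?_, fun z => (1 - (starRingEnd ℂ) κ)⁻¹ * (z / (1 - y * z)) + 0,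
    (isConvexUnivalent_halfPlaneMap hy).const_mul_add (inv_ne_zero hc) 0, fun z hz => ?_⟩
  · rw [(hasDerivAt_extremalFunction hy.le zero_mem_disk).deriv]
    simp
  · have hne := one_sub_mul_ne_zero hy.le hz
    have hg : deriv (fun z => (1 - (starRingEnd ℂ) κ)⁻¹ * (z / (1 - y * z)) + 0) z = _ :=
      (((hasDerivAt_halfPlaneMap hy.le hz).const_mul _).add_const 0).deriv
    rw [(hasDerivAt_extremalFunction hy.le hz).deriv, hg]
    have hu : ‖y * z‖ < 1 := by rw [norm_mul, hy, one_mul]; exact mem_disk.1 hz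
    have h := re_one_sub_conj_mul_div_pos hκn hκ1 hu
    rw [← mul_assoc, hκy] at h
    convert h using 2
    field_simp

theorem two_sub_add_mul (x y z : ℂ) : 2 - (x + y) * z = (1 - x * z) + (1 - y * z) := by ring

theorem isLogBranch_extremalLog {x y : ℂ} (hx : ‖x‖ ≤ 1) (hy : ‖y‖ ≤ 1) :
    IsLogBranch (extremalFunction x y) (extremalLog x y) := by
  have h1 : ∀ z ∈ disk, 2 - (x + y) * z ∈ Complex.slitPlane := fun z hz => Or.inl <| by
    rw [two_sub_add_mul, Complex.add_re]
    exact add_pos (re_one_sub_mul_pos hx hz) (re_one_sub_mul_pos hy hz)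
  have h2 : ∀ z ∈ disk, 1 - y * z ∈ Complex.slitPlane := fun z hz =>
    Or.inl (re_one_sub_mul_pos hy hz)
  refine ⟨?_, by simp [extremalLog], fun z hz hz0 => ?_⟩
  · have d1 : DifferentiableOn ℂ (fun z : ℂ => 2 - (x + y) * z) disk := by fun_prop
    have d2 : DifferentiableOn ℂ (fun z : ℂ => 1 - y * z) disk := by fun_prop
    exact ((d1.clog h1).sub_const _).sub ((d2.clog h2).const_mul 2)
  · have hne := one_sub_mul_ne_zero hy hz
    rw [extremalLog, Complex.exp_sub, Complex.exp_sub,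
      Complex.exp_log (Complex.slitPlane_ne_zero (h1 z hz)), Complex.exp_log two_ne_zero,
      two_mul (Complex.log _), Complex.exp_add, Complex.exp_log hne, extremalFunction]
    field_simp

theorem extremalLog_mem_extremalValues {x y : ℂ} (hx : ‖x‖ ≤ 1) (hy : ‖y‖ = 1) (hxy : x ≠ y)
    (t : ℝ) {z : ℂ} (hz : z ∈ disk) :
    (Complex.exp (t * Complex.I) * extremalLog x y z).re ∈ extremalValues t closeToConvex :=
  ⟨_, extremalFunction_mem hx hy hxy, _, isLogBranch_extremalLog hx hy.le, z, hz, rfl⟩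

theorem re_one_sub_pos_of_ne {y : ℂ} (hy : ‖y‖ ≤ 1) (hy1 : y ≠ 1) : 0 < (1 - y).re := by
  have h : y.re < 1 := by
    refine lt_of_le_of_ne ((Complex.re_le_norm y).trans hy) fun h => hy1 ?_
    have hn : Complex.normSq y ≤ 1 := by
      rw [Complex.normSq_eq_norm_sq]; nlinarith [norm_nonneg y]
    rw [Complex.normSq_apply, h] at hn
    apply Complex.ext
    · simp [h]
    · rw [Complex.one_im]; nlinarith
  simpa using h

theorem re_two_sub_pos {x y : ℂ} (hx : ‖x‖ ≤ 1) (hy : ‖y‖ ≤ 1) (hy1 : y ≠ 1) :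
    0 < (2 - (x + y) * 1).re := by
  have h1 := re_one_sub_pos_of_ne hy hy1
  have h2 := (Complex.re_le_norm x).trans hx
  simp at h1 ⊢
  linarith

/-- Boundary values at `z = 1` of the extremal functions are limits of extremal values. -/
theorem le_of_mem_lowerBounds {x y : ℂ} (hx : ‖x‖ ≤ 1) (hy : ‖y‖ = 1) (hxy : x ≠ y) (hy1 : y ≠ 1)
    {t c : ℝ} (hc : c ∈ lowerBounds (extremalValues t closeToConvex)) :
    c ≤ (Complex.exp (t * Complex.I) * extremalLog x y 1).re := by
  have h1 : (2 - (x + y) * ((1 : ℝ) : ℂ)) ∈ Complex.slitPlane :=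
    Or.inl (by simpa using re_two_sub_pos hx hy.le hy1)
  have h2 : 1 - y * ((1 : ℝ) : ℂ) ∈ Complex.slitPlane :=
    Or.inl (by simpa using re_one_sub_pos_of_ne hy.le hy1)
  have hcont : ContinuousAt
      (fun r : ℝ => (Complex.exp (t * Complex.I) * extremalLog x y r).re) 1 := by
    refine Complex.continuous_re.continuousAt.comp (continuousAt_const.mul ?_)
    have c1 : ContinuousAt (fun r : ℝ => 2 - (x + y) * (r : ℂ)) 1 := by fun_prop
    have c2 : ContinuousAt (fun r : ℝ => 1 - y * (r : ℂ)) 1 := by fun_prop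
    exact ((c1.clog h1).sub continuousAt_const).sub (continuousAt_const.mul (c2.clog h2))
  have ht := hcont.tendsto.mono_left (nhdsWithin_le_nhds (s := Iio 1))
  rw [Complex.ofReal_one] at ht
  refine ge_of_tendsto ht ?_
  filter_upwards [Ioo_mem_nhdsLT (show (0 : ℝ) < 1 by norm_num)] with r hr
  refine hc (extremalLog_mem_extremalValues hx hy hxy t ?_)
  rw [mem_disk, Complex.norm_real, Real.norm_of_nonneg hr.1.le]
  exact hr.2

theorem exp_extremalLog_one {x y : ℂ} (hx : ‖x‖ ≤ 1) (hy : ‖y‖ ≤ 1) (hy1 : y ≠ 1) :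
    Complex.exp (extremalLog x y 1) = (2 - (x + y)) / (2 * (1 - y) ^ 2) := by
  have h1 : 2 - (x + y) * 1 ≠ 0 := Complex.slitPlane_ne_zero (Or.inl (re_two_sub_pos hx hy hy1))
  have h2 : 1 - y * 1 ≠ 0 := by rw [mul_one]; exact sub_ne_zero.2 hy1.symm
  rw [extremalLog, Complex.exp_sub, Complex.exp_sub, Complex.exp_log h1,
    Complex.exp_log two_ne_zero, two_mul (Complex.log _), Complex.exp_add, Complex.exp_log h2,
    mul_one, mul_one, div_div, pow_two]

theorem im_extremalLog_one (x y : ℂ) :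
    (extremalLog x y 1).im = (2 - (x + y) * 1).arg - 2 * (1 - y).arg := by
  simp [extremalLog, Complex.log_im]

theorem eq_of_exp_eq_of_abs_im_sub_lt {A B : ℂ} (h : Complex.exp A = Complex.exp B)
    (him : |A.im - B.im| < 2 * Real.pi) : A = B := by
  obtain ⟨n, hn⟩ := Complex.exp_eq_exp_iff_exists_int.1 h
  have h1 : A.im - B.im = n * (2 * Real.pi) := by
    rw [hn]; simp
  rw [h1, abs_mul, abs_of_pos Real.two_pi_pos] at him
  have h2 : |(n : ℝ)| < 1 := by
    have := Real.two_pi_pos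
    by_contra hcon
    nlinarith [not_lt.1 hcon]
  have h3 : n = 0 := by
    rw [← Int.cast_abs] at h2
    exact Int.abs_lt_one_iff.1 (by exact_mod_cast h2)
  rw [hn, h3]
  simp

theorem re_exp_mul_I_mul (t : ℝ) (L : ℂ) :
    (Complex.exp (t * Complex.I) * L).re = Real.cos t * L.re - Real.sin t * L.im := by
  rw [Complex.mul_re, Complex.exp_ofReal_mul_I_re, Complex.exp_ofReal_mul_I_im]

/-- The value `-arcSup` is approached: the point with `1 / w = 1 + 3 e` on the rim, where `|e| = 1`,
is the boundary value of the extremal function with `y = -e` and `x = e (e + 3) / (1 + 3 e)`. -/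
theorem le_arc_value {t c : ℝ} (ht : |t| < Real.pi / 2) (hb : 8 * Real.tan t ^ 2 < 1)
    (hc : c ∈ lowerBounds (extremalValues t closeToConvex)) :
    c ≤ -Real.cos t * arcSup (Real.tan t) := by
  have htpos : 0 < Real.cos t := Real.cos_pos_of_mem_Ioo (abs_lt.1 ht)
  rw [← rimLog_critical hb]
  set a := Real.arctan (3 * Real.tan t / √(1 - 8 * Real.tan t ^ 2)) with ha
  have hcosa : 0 < Real.cos a := Real.cos_arctan_pos _
  obtain ⟨ha1, ha2⟩ := Real.arctan_mem_Ioo (3 * Real.tan t / √(1 - 8 * Real.tan t ^ 2))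
  set ρ := Real.cos a + √(Real.cos a ^ 2 + 8) with hρ
  have hρ0 : 0 < ρ := rim_pos a
  have hρsq : ρ ^ 2 - 2 * ρ * Real.cos a = 8 := by
    have : √(Real.cos a ^ 2 + 8) ^ 2 = Real.cos a ^ 2 + 8 := Real.sq_sqrt (by positivity)
    rw [hρ]; linear_combination this
  set v : ℂ := Complex.exp (-((Real.log ρ : ℝ) : ℂ) + a * Complex.I) with hv
  set e : ℂ := (v⁻¹ - 1) / 3 with he
  have hvinv : v⁻¹ = ((ρ * Real.cos a : ℝ) : ℂ) - ((ρ * Real.sin a : ℝ) : ℂ) * Complex.I := by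
    rw [hv, ← Complex.exp_neg, neg_add, neg_neg, Complex.exp_add, ← Complex.ofReal_exp,
      Real.exp_log hρ0, ← neg_mul, ← Complex.ofReal_neg, Complex.exp_mul_I, ← Complex.ofReal_cos,
      ← Complex.ofReal_sin, Real.cos_neg, Real.sin_neg]
    push_cast
    ring
  have hv3 : 1 + 3 * e = v⁻¹ := by rw [he]; ring
  have hv0 : v⁻¹ ≠ 0 := inv_ne_zero (Complex.exp_ne_zero _)
  have h3e : 1 + 3 * e ≠ 0 := by rw [hv3]; exact hv0
  have hre : e.re = (ρ * Real.cos a - 1) / 3 := by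
    have := congrArg Complex.re (hv3.trans hvinv)
    simp [-Complex.ofReal_mul] at this
    linarith
  have him : e.im = -(ρ * Real.sin a) / 3 := by
    have := congrArg Complex.im (hv3.trans hvinv)
    simp [-Complex.ofReal_mul] at this
    linarith
  have hesq : e.re * e.re + e.im * e.im = 1 := by
    rw [hre, him]
    linear_combination (1 / 9) * hρsq + (ρ ^ 2 / 9) * Real.sin_sq_add_cos_sq a
  have hen : ‖e‖ = 1 := by
    rw [← sq_eq_sq₀ (norm_nonneg _) zero_le_one, Complex.sq_norm, Complex.normSq_apply, hesq,
      one_pow]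
  have he1 : e ≠ -1 := by
    intro h
    rw [h] at hre
    simp at hre
    have := mul_pos hρ0 hcosa
    linarith
  have hxn : ‖e * (e + 3) / (1 + 3 * e)‖ = 1 := by
    have h1 : ‖e + 3‖ = ‖1 + 3 * e‖ := by
      rw [← sq_eq_sq₀ (norm_nonneg _) (norm_nonneg _), Complex.sq_norm, Complex.sq_norm,
        Complex.normSq_apply, Complex.normSq_apply]
      simp
      linear_combination -8 * hesq
    rw [norm_div, norm_mul, hen, one_mul, h1, div_self (norm_ne_zero_iff.2 h3e)]
  have hyn : ‖-e‖ = 1 := by rw [norm_neg, hen]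
  have hy1 : -e ≠ 1 := fun h => he1 (by rw [← h, neg_neg])
  have hxy : e * (e + 3) / (1 + 3 * e) ≠ -e := by
    intro h
    rw [div_eq_iff h3e] at h
    have he0 : e ≠ 0 := fun h0 => by rw [h0, norm_zero] at hen; exact zero_ne_one hen
    apply he1
    have h2 : e * (e + 1) = 0 := by linear_combination h / 4
    exact eq_neg_of_add_eq_zero_left ((mul_eq_zero.1 h2).resolve_left he0)
  have hmain := le_of_mem_lowerBounds hxn.le hyn hxy hy1 hc
  have hval : extremalLog (e * (e + 3) / (1 + 3 * e)) (-e) 1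
      = -((Real.log ρ : ℝ) : ℂ) + a * Complex.I := by
    refine eq_of_exp_eq_of_abs_im_sub_lt ?_ ?_
    · rw [exp_extremalLog_one hxn.le hyn.le hy1, ← hv, ← inv_inv v, ← hv3]
      have : 1 - -e ≠ 0 := sub_ne_zero.2 hy1.symm
      rw [div_eq_iff (mul_ne_zero two_ne_zero (pow_ne_zero 2 this))]
      linear_combination (-(2 + e)) * mul_inv_cancel₀ h3e
    · rw [im_extremalLog_one]
      have h1 := abs_lt.1 (Complex.abs_arg_lt_pi_div_two_iff.2
        (Or.inl (re_two_sub_pos hxn.le hyn.le hy1)))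
      have h2 := abs_lt.1 (Complex.abs_arg_lt_pi_div_two_iff.2
        (Or.inl (re_one_sub_pos_of_ne hyn.le hy1)))
      have h3 : (-((Real.log ρ : ℝ) : ℂ) + a * Complex.I).im = a := by simp
      rw [h3, abs_lt]
      constructor <;> linarith [h1.1, h1.2, h2.1, h2.2]
  rw [hval, re_exp_mul_I_mul] at hmain
  have h4 : (-((Real.log ρ : ℝ) : ℂ) + a * Complex.I).re = -Real.log ρ := by simp
  have h5 : (-((Real.log ρ : ℝ) : ℂ) + a * Complex.I).im = a := by simp
  rw [h4, h5] at hmain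
  refine hmain.trans (le_of_eq ?_)
  have htan : Real.tan t * Real.cos t = Real.sin t := Real.tan_mul_cos htpos.ne'
  rw [rimLog]
  linear_combination (-a) * -htan

/-- The points `-l * (1 + i tan T) / 2` with `l > 1`, taken with argument `T + π`, are boundary values
of extremal functions whose parameters `x` and `y` are close to `1`. They lie just to the left of the
line `Re w = -1 / 2`. -/
theorem exists_extremalLog_eq {T l : ℝ} (hT0 : 0 ≤ T) (hT : T < Real.pi / 2) (hl : 1 < l) :
    ∃ x y : ℂ, ‖x‖ ≤ 1 ∧ ‖y‖ = 1 ∧ x ≠ y ∧ y ≠ 1 ∧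
      extremalLog x y 1 = ((Real.log (l / (2 * Real.cos T)) : ℝ) : ℂ) +
        ((T + Real.pi : ℝ) : ℂ) * Complex.I := by
  have hcos : 0 < Real.cos T := Real.cos_pos_of_mem_Ioo ⟨by linarith, hT⟩
  set μ : ℂ := ((l / Real.cos T : ℝ) : ℂ) * Complex.exp (T * Complex.I) with hμ
  have hμre : μ.re = l := by
    rw [hμ, Complex.re_ofReal_mul, Complex.exp_ofReal_mul_I_re, div_mul_cancel₀ _ hcos.ne']
  have hμ0 : μ ≠ 0 := by
    intro h
    rw [h, Complex.zero_re] at hμre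
    linarith
  -- The parameter `y = exp (i η)` is close to `1` and above the real axis. The inequality, which holds
  -- at `η = 0` because `l > 1`, makes `|x| ≤ 1` for the parameter `x` that gives the value `-μ / 2`.
  obtain ⟨η, hη, hlt⟩ : ∃ η ∈ Ioo 0 Real.pi,
      ‖1 + μ * (1 - Complex.exp (η * Complex.I))‖ ^ 2 <
        -1 + 2 * (μ * Complex.exp (η * Complex.I)).re := by
    have hcont : ContinuousAt (fun η : ℝ => -1 + 2 * (μ * Complex.exp (η * Complex.I)).re -
        ‖1 + μ * (1 - Complex.exp (η * Complex.I))‖ ^ 2) 0 := by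
      have h1 : Continuous fun η : ℝ => Complex.exp (η * Complex.I) := by fun_prop
      have h2 : Continuous fun η : ℝ => (μ * Complex.exp (η * Complex.I)).re :=
        Complex.continuous_re.comp (continuous_const.mul h1)
      have h3 : Continuous fun η : ℝ => ‖1 + μ * (1 - Complex.exp (η * Complex.I))‖ ^ 2 := by
        fun_prop
      exact ((continuous_const.add (continuous_const.mul h2)).sub h3).continuousAt
    have hev := hcont.tendsto.eventually (lt_mem_nhds (a := 0) (by
      simp [hμre]; linarith))
    have hev' := (hev.filter_mono (nhdsWithin_le_nhds (s := Ioi 0))).and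
      (Ioo_mem_nhdsGT Real.pi_pos)
    obtain ⟨η, h1, h2⟩ := hev'.exists
    exact ⟨η, h2, by linarith⟩
  set y : ℂ := Complex.exp (η * Complex.I) with hy
  have hyn : ‖y‖ = 1 := Complex.norm_exp_ofReal_mul_I η
  have hyim : 0 < y.im := by
    rw [hy, Complex.exp_ofReal_mul_I_im]
    exact Real.sin_pos_of_pos_of_lt_pi hη.1 hη.2
  have hy1 : y ≠ 1 := by
    intro h
    rw [h] at hyim
    simp at hyim
  set q : ℂ := 1 - y with hq
  have hq0 : q ≠ 0 := sub_ne_zero.2 hy1.symm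
  have hysq : y.re * y.re + y.im * y.im = 1 := by
    rw [← Complex.normSq_apply, Complex.normSq_eq_norm_sq, hyn, one_pow]
  have hqsq : q ^ 2 = -((Complex.normSq q : ℝ) : ℂ) * y := by
    have hyy : y * (starRingEnd ℂ) y = 1 := by
      rw [Complex.mul_conj, Complex.normSq_eq_norm_sq, hyn]; norm_num
    rw [← Complex.mul_conj, hq, map_sub, map_one]
    linear_combination (-1 + y) * hyy
  have hqre : q.re = Complex.normSq q / 2 := by
    rw [Complex.normSq_apply, hq]
    simp
    linarith
  have hqpos := Complex.normSq_pos.2 hq0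
  set x : ℂ := 1 + q + μ * q ^ 2 with hx
  have hxn : ‖x‖ ≤ 1 := by
    have h1 : x = 1 + q * (1 + μ * q) := by rw [hx]; ring
    have h2 : (q * (1 + μ * q)).re = Complex.normSq q * (1 / 2 - (μ * y).re) := by
      have : q * (1 + μ * q) = q - ((Complex.normSq q : ℝ) : ℂ) * (μ * y) := by
        linear_combination μ * hqsq
      rw [this, Complex.sub_re, Complex.re_ofReal_mul, hqre]
      ring
    have h3 : Complex.normSq (q * (1 + μ * q)) = Complex.normSq q * ‖1 + μ * q‖ ^ 2 := by
      rw [Complex.normSq_mul, Complex.normSq_eq_norm_sq (1 + μ * q)]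
    have h4 : Complex.normSq x = 1 + 2 * (q * (1 + μ * q)).re + Complex.normSq (q * (1 + μ * q)) := by
      rw [h1, Complex.normSq_apply, Complex.normSq_apply]
      simp only [Complex.add_re, Complex.add_im, Complex.one_re, Complex.one_im]
      ring
    rw [← sq_le_sq₀ (norm_nonneg _) zero_le_one, Complex.sq_norm, h4, h2, h3]
    nlinarith
  have hsum : 2 - (x + y) = -(μ * q ^ 2) := by rw [hx, hq]; ring
  have hexp : Complex.exp (extremalLog x y 1) = -μ / 2 := by
    rw [exp_extremalLog_one hxn hyn.le hy1, hsum, ← hq]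
    field_simp
  have hxy : x ≠ y := by
    intro h
    -- `x = y` would force `1 + μ q / 2 = 0`, which contradicts `Re μ > 0`
    have h1 : q * (2 + μ * q) = 0 := by
      have : x - y = q * (2 + μ * q) := by rw [hx, hq]; ring
      rw [← this, h, sub_self]
    have h2 : μ * q = -2 := by
      have := (mul_eq_zero.1 h1).resolve_left hq0
      linear_combination this
    have h3 : μ * y = μ + 2 := by
      have : μ * y = μ - μ * q := by rw [hq]; ring
      rw [this, h2]; ring
    have h4 : Complex.normSq (μ * y) = Complex.normSq (μ + 2) := by rw [h3]
    rw [Complex.normSq_mul, Complex.normSq_eq_norm_sq y, hyn, Complex.normSq_apply,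
      Complex.normSq_apply] at h4
    simp [hμre] at h4
    nlinarith
  refine ⟨x, y, hxn, hyn, hxy, hy1, eq_of_exp_eq_of_abs_im_sub_lt ?_ ?_⟩
  · rw [hexp, hμ, Complex.exp_add, ← Complex.ofReal_exp, Real.exp_log (by positivity),
      Complex.ofReal_add, add_mul, Complex.exp_add, Complex.exp_pi_mul_I]
    push_cast
    field_simp
  · rw [im_extremalLog_one]
    have h1 := abs_lt.1 (Complex.abs_arg_lt_pi_div_two_iff.2
      (Or.inl (re_two_sub_pos hxn hyn.le hy1)))
    have h2 := abs_lt.1 (Complex.abs_arg_lt_pi_div_two_iff.2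
      (Or.inl (re_one_sub_pos_of_ne hyn.le hy1)))
    have h3 : (1 - y).arg < 0 := by
      rw [Complex.arg_neg_iff]
      simpa using hyim
    have h4 : (((Real.log (l / (2 * Real.cos T)) : ℝ) : ℂ) +
        ((T + Real.pi : ℝ) : ℂ) * Complex.I).im = T + Real.pi := by
      simp [-Complex.ofReal_add]
    rw [h4, abs_lt]
    constructor <;> linarith [h1.1, h1.2, h2.1, h2.2]

theorem extremalLog_conj {x y : ℂ} (hx : ‖x‖ ≤ 1) (hy : ‖y‖ ≤ 1) (hy1 : y ≠ 1) :
    extremalLog ((starRingEnd ℂ) x) ((starRingEnd ℂ) y) 1 =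
      (starRingEnd ℂ) (extremalLog x y 1) := by
  have h1 := (Complex.mem_slitPlane_iff_arg.1 (Or.inl (re_two_sub_pos hx hy hy1) :
    2 - (x + y) * 1 ∈ Complex.slitPlane)).1
  have h2 := (Complex.mem_slitPlane_iff_arg.1 (Or.inl (re_one_sub_pos_of_ne hy hy1) :
    1 - y ∈ Complex.slitPlane)).1
  have h3 : (starRingEnd ℂ) (Complex.log 2) = Complex.log 2 := by
    rw [← Complex.ofReal_ofNat, ← Complex.ofReal_log (by norm_num), Complex.conj_ofReal]
  have h4 : (starRingEnd ℂ) (2 : ℂ) = 2 := Complex.conj_ofNat 2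
  rw [mul_one] at h1
  simp only [extremalLog, mul_one, map_sub, map_mul, h3, h4, ← Complex.log_conj _ h1,
    ← Complex.log_conj _ h2, map_add, map_one]

/-- The value `-lineSup` is approached as `l` tends to `1` in `exists_extremalLog_eq`. For negative `t`
the conjugate functions are used. -/
theorem le_line_value {t c : ℝ} (ht : |t| < Real.pi / 2)
    (hc : c ∈ lowerBounds (extremalValues t closeToConvex)) :
    c ≤ -Real.cos t * Real.log (2 * Real.cos t) - |Real.sin t| * (|t| + Real.pi) := by
  have htpos : 0 < Real.cos t := Real.cos_pos_of_mem_Ioo (abs_lt.1 ht)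
  refine le_of_forall_pos_le_add fun ε hε => ?_
  obtain ⟨x, y, hx, hy, hxy, hy1, hval⟩ :=
    exists_extremalLog_eq (abs_nonneg t) ht (Real.one_lt_exp_iff.2 hε)
  rw [Real.cos_abs, Real.log_div (Real.exp_ne_zero _) (by positivity), Real.log_exp] at hval
  set X := ε - Real.log (2 * Real.cos t) with hX
  have hre : (((X : ℝ) : ℂ) + ((|t| + Real.pi : ℝ) : ℂ) * Complex.I).re = X := by
    simp [-Complex.ofReal_add]
  have him : (((X : ℝ) : ℂ) + ((|t| + Real.pi : ℝ) : ℂ) * Complex.I).im = |t| + Real.pi := by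
    simp [-Complex.ofReal_add]
  have hcε : Real.cos t * ε ≤ ε := mul_le_of_le_one_left hε.le (Real.cos_le_one t)
  rcases le_total 0 t with h | h
  · have hmain := le_of_mem_lowerBounds hx hy hxy hy1 hc
    have hs : |Real.sin t| = Real.sin t := abs_of_nonneg
      (Real.sin_nonneg_of_nonneg_of_le_pi h (by linarith [(abs_lt.1 ht).2, Real.pi_pos]))
    rw [hval, re_exp_mul_I_mul, hre, him] at hmain
    rw [hs]
    linarith
  · have hmain := le_of_mem_lowerBounds (x := (starRingEnd ℂ) x) (y := (starRingEnd ℂ) y)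
      (by simpa using hx) (by simpa using hy) (fun h => hxy ((starRingEnd ℂ).injective h))
      (fun h => hy1 ((starRingEnd ℂ).injective (by rw [h, map_one]))) hc
    have hs : |Real.sin t| = -Real.sin t := abs_of_nonpos
      (Real.sin_nonpos_of_nonpos_of_neg_pi_le h (by linarith [(abs_lt.1 ht).1, Real.pi_pos]))
    rw [extremalLog_conj hx hy.le hy1, hval, re_exp_mul_I_mul, Complex.conj_re, Complex.conj_im,
      hre, him] at hmain
    rw [hs]
    linarith

/-- The Koebe function is unbounded along the positive radius. -/
theorem not_bddAbove_extremalValues {t : ℝ} (ht : |t| < Real.pi / 2) :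
    ¬ BddAbove (extremalValues t closeToConvex) := by
  have htpos : 0 < Real.cos t := Real.cos_pos_of_mem_Ioo (abs_lt.1 ht)
  rintro ⟨B, hB⟩
  set N := |B| / Real.cos t + 1 with hN
  have hN0 : 0 < N := by positivity
  have hlt : Real.exp (-N) < 1 := Real.exp_lt_one_iff.2 (by linarith)
  have hz : ((1 - Real.exp (-N) : ℝ) : ℂ) ∈ disk := by
    rw [mem_disk, Complex.norm_real, Real.norm_of_nonneg (by linarith)]
    linarith [Real.exp_pos (-N)]
  have h := hB (extremalLog_mem_extremalValues (x := -1) (y := 1) (by simp) (by simp)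
    (by norm_num) t hz)
  have hL : extremalLog (-1) 1 ((1 - Real.exp (-N) : ℝ) : ℂ) = ((2 * N : ℝ) : ℂ) := by
    have h1 : (1 : ℂ) - 1 * ((1 - Real.exp (-N) : ℝ) : ℂ) = ((Real.exp (-N) : ℝ) : ℂ) := by
      push_cast; ring
    rw [extremalLog, h1, ← Complex.ofReal_log (Real.exp_pos _).le, Real.log_exp]
    push_cast
    simp
  rw [hL, re_exp_mul_I_mul, Complex.ofReal_re, Complex.ofReal_im] at h
  have h2 : Real.cos t * N = |B| + Real.cos t := by
    rw [hN]; field_simp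
  nlinarith [le_abs_self B, abs_nonneg B]

/-! ### The lower bound and the infimum -/

/-- With `ρ = exp (-Re L)` the hypothesis is `ρ ^ 2 - 2 * ρ * cos (Im L) < 8`. -/
theorem neg_re_le_rimLog {L : ℂ} (h : ‖(Complex.exp L)⁻¹ - 1‖ < 3) : -L.re ≤ rimLog L.im := by
  have hsq : ‖(Complex.exp L)⁻¹ - 1‖ ^ 2 < 9 := by
    nlinarith [norm_nonneg ((Complex.exp L)⁻¹ - 1)]
  rw [← Complex.exp_neg, Complex.sq_norm, Complex.normSq_apply, Complex.sub_re, Complex.sub_im,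
    Complex.exp_re, Complex.exp_im, Complex.neg_re, Complex.neg_im, Real.cos_neg, Real.sin_neg,
    Complex.one_re, Complex.one_im] at hsq
  set ρ := Real.exp (-L.re) with hρ
  have h1 : (ρ - Real.cos L.im) ^ 2 < Real.cos L.im ^ 2 + 8 := by
    have hcs : ρ ^ 2 * (Real.sin L.im ^ 2 + Real.cos L.im ^ 2) = ρ ^ 2 * 1 := by
      rw [Real.sin_sq_add_cos_sq]
    linarith
  have h2 := Real.lt_sqrt_of_sq_lt h1
  rw [rimLog, Real.le_log_iff_exp_le (rim_pos _)]
  linarith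

theorem neg_re_le_log_two_mul_cos {L : ℂ} (h : (Complex.exp L).re < -1 / 2) :
    -L.re ≤ Real.log (2 * Real.cos (|L.im| - Real.pi)) := by
  rw [Complex.exp_re] at h
  have hX := Real.exp_pos L.re
  have hXX : Real.exp (-L.re) * Real.exp L.re = 1 := by rw [← Real.exp_add]; simp
  have h1 : 1 < 2 * Real.cos (|L.im| - Real.pi) * Real.exp L.re := by
    rw [Real.cos_sub_pi, Real.cos_abs]
    linarith
  have h2 : Real.exp (-L.re) ≤ 2 * Real.cos (|L.im| - Real.pi) := by
    by_contra! hcon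
    nlinarith
  rwa [Real.le_log_iff_exp_le ((Real.exp_pos _).trans_le h2)]

/-- The two constraints on the values of `log (f z / z)`: the modulus is bounded below by the circle
`|1 / w - 1| = 3` as long as the argument has size at most `π`, and by the line `Re w = -1 / 2`
beyond. -/
theorem IsLogBranch.neg_re_le {f L : ℂ → ℂ} (hf : f ∈ closeToConvex) (hL : IsLogBranch f L) {z : ℂ}
    (hz : z ∈ disk) :
    -(L z).re ≤ rimLog |(L z).im| ∧ (Real.pi < |(L z).im| → |(L z).im| - Real.pi < Real.pi / 2 ∧
      -(L z).re ≤ Real.log (2 * Real.cos (|(L z).im| - Real.pi))) := by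
  obtain ⟨s, M, hs, hM, hs1, hM1, h⟩ := exists_factorization hf
  have hLz := hL.eqOn (isLogBranch_log_add_log hs hM hs1 hM1 (fun z hz => (h z hz).1)
    (fun z hz => (h z hz).2.1) fun z hz => (h z hz).2.2.1) hz
  obtain ⟨-, hsre, hMs, hseg⟩ := h z hz
  have hs0 : s z ≠ 0 := fun h0 => by simp [h0] at hsre
  have hexp : Complex.exp (L z) = s z * M z := by
    rw [hLz, Complex.exp_add, Complex.exp_log hs0, Complex.exp_log (Complex.slitPlane_ne_zero hMs)]
  have him : (L z).im = (s z).arg + (M z).arg := by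
    rw [hLz]; simp [Complex.log_im]
  refine ⟨?_, fun hpi => ⟨?_, neg_re_le_log_two_mul_cos ?_⟩⟩
  · have h1 := (hseg 1 ⟨zero_le_one, le_rfl⟩).2
    have h2 : s z * (1 - ((1 : ℝ) : ℂ) + ((1 : ℝ) : ℂ) * M z) = s z * M z := by push_cast; ring
    rw [h2, ← hexp] at h1
    have h3 := neg_re_le_rimLog h1
    rwa [rimLog, ← Real.cos_abs] at h3
  · have h1 := Complex.abs_arg_lt_pi_div_two_iff.2 (Or.inl hsre)
    have h2 := Complex.abs_arg_le_pi (M z)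
    have h3 := abs_add_le (s z).arg (M z).arg
    rw [him]
    linarith
  · rw [hexp]
    rw [him] at hpi
    rcases lt_abs.1 hpi with h1 | h1
    · exact re_mul_lt_of_pi_lt_arg_add_arg hsre hMs hseg h1
    · exact re_mul_lt_of_arg_add_arg_lt hsre hMs hseg (by linarith)

theorem IsLogBranch.neg_re_add_le_max {f L : ℂ → ℂ} (hf : f ∈ closeToConvex)
    (hL : IsLogBranch f L) {z : ℂ} (hz : z ∈ disk) {b : ℝ} (hb0 : 0 ≤ b) (hb : 8 * b ^ 2 < 1) :
    -(L z).re + b * |(L z).im| ≤ max (arcSup b) (lineSup b) := by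
  obtain ⟨h1, h2⟩ := hL.neg_re_le hf hz
  rcases le_or_gt |(L z).im| Real.pi with h | h
  · calc -(L z).re + b * |(L z).im| ≤ rimLog |(L z).im| + b * |(L z).im| := by gcongr
      _ ≤ max (arcSup b) (Real.log 2 + b * Real.pi) :=
        rimLog_add_le_max hb0 hb (abs_nonneg _) h
      _ ≤ max (arcSup b) (lineSup b) := max_le_max le_rfl (log_two_add_le_lineSup b)
  · obtain ⟨h3, h4⟩ := h2 h
    have h5 := log_two_mul_cos_add_le b (φ := |(L z).im| - Real.pi)
      (by linarith [Real.pi_pos]) h3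
    rw [sub_add_cancel] at h5
    exact (by linarith : _ ≤ lineSup b).trans (le_max_right _ _)

theorem IsLogBranch.neg_re_add_le_lineSup {f L : ℂ → ℂ} (hf : f ∈ closeToConvex)
    (hL : IsLogBranch f L) {z : ℂ} (hz : z ∈ disk) {b : ℝ} (hb0 : 0 ≤ b) (hb : 1 ≤ 8 * b ^ 2) :
    -(L z).re + b * |(L z).im| ≤ lineSup b := by
  obtain ⟨h1, h2⟩ := hL.neg_re_le hf hz
  rcases le_or_gt |(L z).im| Real.pi with h | h
  · calc -(L z).re + b * |(L z).im| ≤ rimLog |(L z).im| + b * |(L z).im| := by gcongr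
      _ ≤ Real.log 2 + b * Real.pi := rimLog_add_le_of_one_le hb0 hb (abs_nonneg _) h
      _ ≤ lineSup b := log_two_add_le_lineSup b
  · obtain ⟨h3, h4⟩ := h2 h
    have h5 := log_two_mul_cos_add_le b (φ := |(L z).im| - Real.pi)
      (by linarith [Real.pi_pos]) h3
    rw [sub_add_cancel] at h5
    linarith

theorem abs_sin_eq {t : ℝ} (ht : |t| < Real.pi / 2) :
    |Real.sin t| = Real.cos t * |Real.tan t| := by
  have hpos : 0 < Real.cos t := Real.cos_pos_of_mem_Ioo (abs_lt.1 ht)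
  rw [← Real.tan_mul_cos hpos.ne', abs_mul, abs_of_pos hpos, mul_comm]

theorem mem_lowerBounds_extremalValues {t C : ℝ} (ht : |t| < Real.pi / 2)
    (h : ∀ f ∈ closeToConvex, ∀ L, IsLogBranch f L → ∀ z ∈ disk,
      -(L z).re + |Real.tan t| * |(L z).im| ≤ C) :
    -Real.cos t * C ∈ lowerBounds (extremalValues t closeToConvex) := by
  have hpos : 0 < Real.cos t := Real.cos_pos_of_mem_Ioo (abs_lt.1 ht)
  rintro _ ⟨f, hf, L, hL, z, hz, rfl⟩
  have h1 := mul_le_mul_of_nonneg_left (h f hf L hL z hz) hpos.le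
  have h2 : Real.sin t * (L z).im ≤ Real.cos t * |Real.tan t| * |(L z).im| := by
    rw [← abs_sin_eq ht, ← abs_mul]
    exact le_abs_self _
  rw [re_exp_mul_I_mul]
  linarith

theorem arcSup_abs (b : ℝ) : arcSup |b| = arcSup b := by
  rcases abs_choice b with h | h <;> rw [h]
  simp [arcSup, neg_div, Real.arctan_neg]

theorem arc_value_eq {t : ℝ} (ht : |t| < Real.pi / 2) :
    -(1 / 2) * Real.cos t *
        Real.log (2 * (9 * Real.cos t ^ 2 - 4 +
          3 * Real.cos t ^ 2 * √(1 - 8 * Real.tan t ^ 2))) -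
      Real.sin t * Real.arctan (3 * Real.tan t / √(1 - 8 * Real.tan t ^ 2)) =
    -Real.cos t * arcSup (Real.tan t) := by
  have hpos : 0 < Real.cos t := Real.cos_pos_of_mem_Ioo (abs_lt.1 ht)
  have hsin := Real.tan_mul_cos hpos.ne'
  have hcos : Real.cos t ^ 2 * (1 + Real.tan t ^ 2) = 1 := by
    linear_combination (Real.tan t * Real.cos t + Real.sin t) * hsin + Real.sin_sq_add_cos_sq t
  have h1 : 2 * (9 * Real.cos t ^ 2 - 4 + 3 * Real.cos t ^ 2 * √(1 - 8 * Real.tan t ^ 2)) =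
      2 * (5 - 4 * Real.tan t ^ 2 + 3 * √(1 - 8 * Real.tan t ^ 2)) / (1 + Real.tan t ^ 2) := by
    rw [eq_div_iff (by positivity)]
    linear_combination (18 + 6 * √(1 - 8 * Real.tan t ^ 2)) * hcos
  rw [h1, arcSup, ← hsin]
  ring

theorem line_value_eq {t : ℝ} (ht : |t| < Real.pi / 2) :
    -Real.cos t * Real.log (2 * Real.cos t) - |Real.sin t| * (|t| + Real.pi) =
      -Real.cos t * lineSup |Real.tan t| := by
  have habs : Real.arctan |Real.tan t| = |t| := by
    have htan : |Real.tan t| = Real.tan |t| := by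
      rcases le_total 0 t with h | h
      · rw [abs_of_nonneg h, abs_of_nonneg
          (Real.tan_nonneg_of_nonneg_of_le_pi_div_two h (by linarith [(abs_lt.1 ht).2]))]
      · rw [abs_of_nonpos h, abs_of_nonpos
          (Real.tan_nonpos_of_nonpos_of_neg_pi_div_two_le h (by linarith [(abs_lt.1 ht).1])),
          Real.tan_neg]
    rw [htan, Real.arctan_tan (by linarith [abs_nonneg t, Real.pi_pos]) ht]
  rw [lineSup_eq, habs, Real.cos_abs, abs_sin_eq ht]
  ring

theorem lineSup_le_arcSup {b b₀ : ℝ} (h₀ : IsThreshold b₀) (hb0 : 0 ≤ b) (hb : b ≤ b₀) :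
    lineSup b ≤ arcSup b := by
  obtain ⟨-, h2, h3⟩ := isThreshold_iff.1 h₀
  rcases hb.eq_or_lt with rfl | h
  · exact h3.le
  · linarith [lineSup_sub_arcSup_lt hb0 h h2]

theorem arcSup_le_lineSup {b b₀ : ℝ} (h₀ : IsThreshold b₀) (hb : b₀ ≤ b) (hb1 : 8 * b ^ 2 < 1) :
    arcSup b ≤ lineSup b := by
  obtain ⟨h1, -, h3⟩ := isThreshold_iff.1 h₀
  rcases hb.eq_or_lt with rfl | h
  · exact h3.ge
  · linarith [lineSup_sub_arcSup_lt h1.le h hb1]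

theorem IsThreshold.unique {b c : ℝ} (hb : IsThreshold b) (hc : IsThreshold c) : b = c := by
  obtain ⟨b1, b2, b3⟩ := isThreshold_iff.1 hb
  obtain ⟨c1, c2, c3⟩ := isThreshold_iff.1 hc
  rcases lt_trichotomy b c with h | h | h
  · linarith [lineSup_sub_arcSup_lt b1.le h c2]
  · exact h
  · linarith [lineSup_sub_arcSup_lt c1.le h b2]

theorem isGLB_arc_value {b₀ t : ℝ} (h₀ : IsThreshold b₀) (ht : |t| < Real.pi / 2)
    (h : |Real.tan t| ≤ b₀) :
    IsGLB (extremalValues t closeToConvex) (-Real.cos t * arcSup (Real.tan t)) := by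
  have hb : 8 * |Real.tan t| ^ 2 < 1 := by
    nlinarith [(isThreshold_iff.1 h₀).2.1, abs_nonneg (Real.tan t)]
  rw [← arcSup_abs]
  refine ⟨mem_lowerBounds_extremalValues ht fun f hf L hL z hz => ?_, fun c hc => ?_⟩
  · have h1 := hL.neg_re_add_le_max hf hz (abs_nonneg _) hb
    rwa [max_eq_left (lineSup_le_arcSup h₀ (abs_nonneg _) h)] at h1
  · rw [sq_abs] at hb
    rw [arcSup_abs]
    exact le_arc_value ht hb hc

theorem isGLB_line_value {b₀ t : ℝ} (h₀ : IsThreshold b₀) (ht : |t| < Real.pi / 2)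
    (h : b₀ ≤ |Real.tan t|) :
    IsGLB (extremalValues t closeToConvex) (-Real.cos t * lineSup |Real.tan t|) := by
  refine ⟨mem_lowerBounds_extremalValues ht fun f hf L hL z hz => ?_, fun c hc => ?_⟩
  · rcases lt_or_ge (8 * |Real.tan t| ^ 2) 1 with hb | hb
    · have h1 := hL.neg_re_add_le_max hf hz (abs_nonneg _) hb
      rwa [max_eq_right (arcSup_le_lineSup h₀ h hb)] at h1
    · exact hL.neg_re_add_le_lineSup hf hz (abs_nonneg _) hb
  · rw [← line_value_eq ht]
    exact le_line_value ht hc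

theorem exists_isLogBranch {f : ℂ → ℂ} (hf : f ∈ closeToConvex) : ∃ L, IsLogBranch f L := by
  obtain ⟨s, M, hs, hM, hs1, hM1, h⟩ := exists_factorization hf
  exact ⟨_, isLogBranch_log_add_log hs hM hs1 hM1 (fun z hz => (h z hz).1)
    (fun z hz => (h z hz).2.1) fun z hz => (h z hz).2.2.1⟩

end CloseToConvex

theorem corollary4p3 :
    (∀ f ∈ CloseToConvex.closeToConvex, ∃ L : ℂ → ℂ, CloseToConvex.IsLogBranch f L) ∧
    ∃ b₀ : ℝ, CloseToConvex.IsThreshold b₀ ∧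
      (∀ b : ℝ, CloseToConvex.IsThreshold b → b = b₀) ∧
      (0.24001 ≤ b₀ ∧ b₀ < 0.24002) ∧
      ∀ t : ℝ, |t| < Real.pi / 2 →
        (|Real.tan t| ≤ b₀ →
          IsGLB (CloseToConvex.extremalValues t CloseToConvex.closeToConvex)
            (-(1 / 2) * Real.cos t *
                Real.log (2 * (9 * Real.cos t ^ 2 - 4 +
                  3 * Real.cos t ^ 2 * √(1 - 8 * Real.tan t ^ 2))) -
              Real.sin t * Real.arctan (3 * Real.tan t / √(1 - 8 * Real.tan t ^ 2)))) ∧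
        (b₀ ≤ |Real.tan t| →
          IsGLB (CloseToConvex.extremalValues t CloseToConvex.closeToConvex)
            (-Real.cos t * Real.log (2 * Real.cos t) - |Real.sin t| * (|t| + Real.pi))) ∧
        ¬ BddAbove (CloseToConvex.extremalValues t CloseToConvex.closeToConvex) := by
  refine ⟨fun f hf => CloseToConvex.exists_isLogBranch hf, ?_⟩
  obtain ⟨b₀, h₀, hb₀⟩ := CloseToConvex.exists_threshold
  refine ⟨b₀, h₀, fun b hb => hb.unique h₀, hb₀, fun t ht =>
    ⟨fun h => ?_, fun h => ?_, CloseToConvex.not_bddAbove_extremalValues ht⟩⟩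
  · rw [CloseToConvex.arc_value_eq ht]
    exact CloseToConvex.isGLB_arc_value h₀ ht h
  · rw [CloseToConvex.line_value_eq ht]
    exact CloseToConvex.isGLB_line_value h₀ ht h
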